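/- Let $k$ be a field of characteristic zero, $K$ a finite extension of the field $k(q)$ of rational functions, and $|\cdot|$ an absolute value on $K$ with $|f|=d^{\deg_q f}$ for all nonzero $f\in k[q]$, where $d>1$ is a fixed real number. Let $C$ be the smallest complete and algebraically closed valued extension of $K$. Let $\mathcal{M}er(C^*)$ be the field of meromorphic functions on $C^*=C\smallsetminus\{0\}$, i.e. the field of fractions of the ring of analytic functions on $C^*$ (the Laurent series $\sum_{n\in\mathbb Z}a_nx^n$ over $C$ that converge on all of $C^*$). Let $\sigma_q$ be the operator $f(x)\mapsto f(qx)$ on $\mathcal{M}er(C^*)$, let $\delta_x=x\frac{d}{dx}$, and let $\delta_q$ be the extension to $\mathcal{M}er(C^*)$, with $\delta_q(x)=0$, of the continuous derivation of $C$ that extends $q\frac{d}{dq}$ on $k(q)$. Put $$\theta_q=\sum_{n\in\mathbb Z}q^{-n(n-1)/2}x^n,\qquad \ell_q=\frac{\delta_x(\theta_q)}{\theta_q},\qquad \delta=\ell_q\delta_x+\delta_q .$$ Let $C_E=\mathcal{M}er(C^*)^{\sigma_q}$ be the field of elliptic functions on $C^*/q^{\mathbb Z}$. The derivations $\delta_x,\delta$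 preserve $C_E$ and satisfy $[\delta_x,\delta]=\delta_x(\ell_q)\,\delta_x$, with $\delta_x(\ell_q)\in C_E$. A $(\delta_x,\delta)$-extension is a differential field extension in which this commutation relation still holds. A $(\delta_x,\delta)$-field is closed if every finite system of algebraic differential equations over it which has a solution in some $(\delta_x,\delta)$-extension has a solution in the field itself. A $(\delta_x,\delta)$-closure of $C_E$ is a closed $(\delta_x,\delta)$-extension of $C_E$ which embeds over $C_E$, as a $(\delta_x,\delta)$-field, into every closed $(\delta_x,\delta)$-extension of $C_E$. Let $\widetilde C_E$ be a $(\delta_x,\delta)$-closure of $C_E$, and extend $\sigma_q$ to it by the identity. Then there is a nonzero $h\in\widetilde C_E$ with $$\delta(h)=\delta_x(\ell_q)\,h,$$ such that the derivations $$\partial_1=h\,\delta_x,\qquad \partial_2=\delta\ \ (=\ell_q\delta_x+\delta_q\ \text{on}\ \mathcal{M}er(C^*))$$ commute with each other and with $\sigma_q$. Here $\partial_1$, $\partial_2$ and $\sigma_q$ act on the total ring of fractions of $\widetilde C_E\otimes_{C_E}\mathcal{M}er(C^*)$, which contains $\widetilde C_E$, $\mathcal{M}er(C^*)$ and the field $\widetilde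 C_E(x,\ell_q)$. -/

import Mathlib

open Filter Topology
open scoped Polynomial TensorProduct

namespace QDependency

noncomputable section

set_option linter.unusedSectionVars false

/-! ### Analytic functions on `C* = C \ {0}` -/

section Analytic

universe w

variable (C : Type w) [NormedField C] [IsUltrametricDist C] [CompleteSpace C]

/-- The coefficient families `(a n)`, `n ∈ ℤ`, of the Laurent series `∑ a n x ^ n` that converge
at every point of `C \ {0}`: for every radius `r > 0`, `|a n| r ^ n → 0` as `|n| → ∞`. -/
def laurentFamilies : AddSubgroup (ℤ → C) where
  carrier := {a | ∀ r : ℝ, 0 < r → Tendsto (fun n : ℤ => ‖a n‖ * r ^ n) cofinite (𝓝 0)}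
  zero_mem' := fun r _ => by simp
  add_mem' := by
    intro a b ha hb r hr
    refine squeeze_zero (fun n => by positivity) (fun n => ?_)
      (by simpa using (ha r hr).add (hb r hr))
    have := norm_add_le (a n) (b n)
    have h2 : (0 : ℝ) ≤ r ^ n := by positivity
    simp only [Pi.add_apply]
    nlinarith
  neg_mem' := by
    intro a ha r hr
    simpa using ha r hr

/-- The ring of analytic functions on `C* = C \ {0}`: the everywhere convergent Laurent series. -/
def Analytic : Type w := laurentFamilies C

theorem nonarchimedeanRing : NonarchimedeanRing C :=
  { is_nonarchimedean := NonarchimedeanAddGroup.is_nonarchimedean }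

namespace Analytic

instance : AddCommGroup (Analytic C) := inferInstanceAs (AddCommGroup (laurentFamilies C))

variable {C}

/-- The `n`-th Laurent coefficient. -/
def coeff (f : Analytic C) (n : ℤ) : C := f.1 n

@[ext] theorem ext {f g : Analytic C} (h : ∀ n, f.coeff n = g.coeff n) : f = g :=
  Subtype.ext (funext h)

/-- The analytic function with a given family of coefficients. -/
def ofCoeff (a : ℤ → C) (ha : ∀ r : ℝ, 0 < r → Tendsto (fun n : ℤ => ‖a n‖ * r ^ n) cofinite (𝓝 0)) :
    Analytic C := ⟨a, ha⟩

@[simp] theorem coeff_ofCoeff (a : ℤ → C) (ha) (n : ℤ) : (ofCoeff a ha).coeff n = a n := rfl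
@[simp] theorem coeff_add (f g : Analytic C) (n : ℤ) :
    (f + g).coeff n = f.coeff n + g.coeff n := rfl
@[simp] theorem coeff_zero (n : ℤ) : (0 : Analytic C).coeff n = 0 := rfl
@[simp] theorem coeff_neg (f : Analytic C) (n : ℤ) : (-f).coeff n = -f.coeff n := rfl

theorem tendsto_coeff (f : Analytic C) (r : ℝ) (hr : 0 < r) :
    Tendsto (fun n : ℤ => ‖f.coeff n‖ * r ^ n) cofinite (𝓝 0) := f.2 r hr

theorem tendsto_coeff_zero (f : Analytic C) : Tendsto f.coeff cofinite (𝓝 0) := by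
  have := f.tendsto_coeff 1 one_pos
  simp only [one_zpow, mul_one] at this
  exact tendsto_zero_iff_norm_tendsto_zero.mpr this

theorem summable_coeff (f : Analytic C) : Summable f.coeff :=
  NonarchimedeanAddGroup.summable_of_tendsto_cofinite_zero f.tendsto_coeff_zero

theorem summable_mul (f g : Analytic C) :
    Summable (fun p : ℤ × ℤ => f.coeff p.1 * g.coeff p.2) :=
  haveI := nonarchimedeanRing C
  f.summable_coeff.mul_of_nonarchimedean g.summable_coeff

theorem summable_conv (f g : Analytic C) (n : ℤ) :
    Summable (fun i : ℤ => f.coeff i * g.coeff (n - i)) :=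
  (f.summable_mul g).comp_injective (i := fun i : ℤ => (i, n - i))
    (fun _ _ h => congrArg Prod.fst h)

theorem norm_tsum_le_of_forall_le {ι : Type*} (f : ι → C) {B : ℝ} (hB : 0 ≤ B)
    (h : ∀ i, ‖f i‖ ≤ B) : ‖∑' i, f i‖ ≤ B :=
  IsUltrametricDist.norm_tsum_le_of_forall_le_of_nonneg hB h

theorem norm_tsum_lt_of_forall_lt (f : ℤ → C) (hf : Summable f) {B : ℝ} (hB : 0 < B)
    (h : ∀ i, ‖f i‖ < B) : ‖∑' i, f i‖ < B := by
  have h1 := hf.tendsto_cofinite_zero.norm.eventually (gt_mem_nhds (show ‖(0 : C)‖ < B / 2 by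
    rw [norm_zero]; positivity))
  rw [eventually_cofinite] at h1
  obtain ⟨M, hM, hM'⟩ : ∃ M < B, ∀ n, ¬ ‖f n‖ < B / 2 → ‖f n‖ ≤ M := by
    rcases h1.toFinset.eq_empty_or_nonempty with he | hne
    · refine ⟨0, hB, fun n hn => ?_⟩
      have : n ∈ h1.toFinset := by simpa using hn
      rw [he] at this
      exact absurd this (Finset.notMem_empty _)
    · obtain ⟨m, -, hm'⟩ := h1.toFinset.exists_max_image (fun n => ‖f n‖) hne
      exact ⟨‖f m‖, h m, fun n hn => hm' n (by simpa using hn)⟩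
  refine (norm_tsum_le_of_forall_le f (B := max M (B / 2)) (by positivity) fun n => ?_).trans_lt
    (max_lt hM (by linarith))
  by_cases hn : ‖f n‖ < B / 2
  · exact hn.le.trans (le_max_right _ _)
  · exact (hM' n hn).trans (le_max_left _ _)

theorem exists_bound (f : Analytic C) (r : ℝ) (hr : 0 < r) :
    ∃ M : ℝ, 0 < M ∧ ∀ n, ‖f.coeff n‖ * r ^ n ≤ M := by
  have h1 := (f.tendsto_coeff r hr).eventually (gt_mem_nhds one_pos)
  rw [eventually_cofinite] at h1
  obtain ⟨M, hM⟩ := (h1.image (fun n => ‖f.coeff n‖ * r ^ n)).bddAbove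
  refine ⟨max M 1, by positivity, fun n => ?_⟩
  by_cases hn : ‖f.coeff n‖ * r ^ n < 1
  · exact hn.le.trans (le_max_right _ _)
  · exact (hM ⟨n, hn, rfl⟩).trans (le_max_left _ _)

theorem tendsto_conv (f g : Analytic C) (r : ℝ) (hr : 0 < r) :
    Tendsto (fun n : ℤ => ‖∑' i, f.coeff i * g.coeff (n - i)‖ * r ^ n) cofinite (𝓝 0) := by
  obtain ⟨M, hM, hfM⟩ := f.exists_bound r hr
  obtain ⟨N, hN, hgN⟩ := g.exists_bound r hr
  rw [Metric.tendsto_nhds]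
  intro ε hε
  have h1 := (f.tendsto_coeff r hr).eventually (gt_mem_nhds (show 0 < ε / 2 / N by positivity))
  have h2 := (g.tendsto_coeff r hr).eventually (gt_mem_nhds (show 0 < ε / 2 / M by positivity))
  rw [eventually_cofinite] at h1 h2 ⊢
  refine (h1.image2 (fun i j => i + j) h2).subset ?_
  intro n hn
  by_contra hcon
  apply hn
  have hrn : 0 < r ^ n := by positivity
  have key : ‖∑' i, f.coeff i * g.coeff (n - i)‖ ≤ ε / 2 / r ^ n := by
    refine norm_tsum_le_of_forall_le _ (by positivity) (fun i => ?_)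
    rw [le_div_iff₀ hrn, norm_mul]
    have e : r ^ n = r ^ i * r ^ (n - i) := by rw [← zpow_add₀ hr.ne']; congr 1; ring
    have e2 : ‖f.coeff i‖ * ‖g.coeff (n - i)‖ * r ^ n
        = (‖f.coeff i‖ * r ^ i) * (‖g.coeff (n - i)‖ * r ^ (n - i)) := by rw [e]; ring
    rw [e2]
    by_cases hi : ‖f.coeff i‖ * r ^ i < ε / 2 / N
    · calc _ ≤ ε / 2 / N * N := by
            apply mul_le_mul hi.le (hgN _) (by positivity) (by positivity)
        _ = _ := by field_simp
    · have hj : ‖g.coeff (n - i)‖ * r ^ (n - i) < ε / 2 / M := by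
        by_contra hj
        exact hcon ⟨i, hi, n - i, hj, by ring⟩
      calc _ ≤ M * (ε / 2 / M) := by
            apply mul_le_mul (hfM _) hj.le (by positivity) (by positivity)
        _ = _ := by field_simp
  rw [dist_zero_right, Real.norm_of_nonneg (by positivity)]
  rw [le_div_iff₀ hrn] at key
  linarith

/-- Multiplication of Laurent series (the Cauchy product). -/
instance : Mul (Analytic C) :=
  ⟨fun f g => ofCoeff (fun n => ∑' i, f.coeff i * g.coeff (n - i)) (tendsto_conv f g)⟩

theorem coeff_mul (f g : Analytic C) (n : ℤ) :
    (f * g).coeff n = ∑' i, f.coeff i * g.coeff (n - i) := rfl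

/-- The monomial `a x ^ m`. -/
def monomial (m : ℤ) (a : C) : Analytic C :=
  ofCoeff (Pi.single m a) (by
    intro r hr
    refine tendsto_const_nhds.congr' ?_
    rw [EventuallyEq, eventually_cofinite]
    refine (Set.finite_singleton m).subset ?_
    intro n hn
    by_contra h
    exact hn (by simp [Pi.single_eq_of_ne (show n ≠ m from h)]))

instance : One (Analytic C) := ⟨monomial 0 1⟩

theorem coeff_one (n : ℤ) : (1 : Analytic C).coeff n = (Pi.single 0 1 : ℤ → C) n := rfl

protected theorem mul_comm (f g : Analytic C) : f * g = g * f := by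
  ext n
  rw [coeff_mul, coeff_mul, ← (Equiv.subLeft n).tsum_eq]
  refine tsum_congr fun i => ?_
  simp [_root_.mul_comm]

protected theorem one_mul (f : Analytic C) : 1 * f = f := by
  ext n
  rw [coeff_mul, tsum_eq_single 0]
  · simp [coeff_one]
  · intro i hi
    simp [coeff_one, Pi.single_eq_of_ne hi]

protected theorem mul_add (f g h : Analytic C) : f * (g + h) = f * g + f * h := by
  ext n
  simp only [coeff_mul, coeff_add, mul_add]
  exact (f.summable_conv g n).tsum_add (f.summable_conv h n)

protected theorem mul_assoc (f g h : Analytic C) : f * g * h = f * (g * h) := by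
  ext n
  have hs : Summable (fun p : ℤ × ℤ => f.coeff p.1 * g.coeff (p.2 - p.1) * h.coeff (n - p.2)) := by
    have := nonarchimedeanRing C
    have := (f.summable_mul g).mul_of_nonarchimedean h.summable_coeff
    exact this.comp_injective (i := fun p : ℤ × ℤ => ((p.1, p.2 - p.1), n - p.2))
      (fun p p' hp => by
        simp only [Prod.mk.injEq] at hp
        ext <;> omega)
  simp only [coeff_mul]
  calc ∑' j, (∑' i, f.coeff i * g.coeff (j - i)) * h.coeff (n - j)
      = ∑' j, ∑' i, f.coeff i * g.coeff (j - i) * h.coeff (n - j) := by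
        refine tsum_congr fun j => ?_
        rw [tsum_mul_right]
    _ = ∑' i, ∑' j, f.coeff i * g.coeff (j - i) * h.coeff (n - j) := hs.tsum_comm
    _ = ∑' i, f.coeff i * ∑' m, g.coeff m * h.coeff (n - i - m) := by
        refine tsum_congr fun i => ?_
        rw [← tsum_mul_left, ← (Equiv.addRight i).tsum_eq]
        refine tsum_congr fun m => ?_
        simp only [Equiv.coe_addRight, add_sub_cancel_right]
        rw [_root_.mul_assoc, show n - (m + i) = n - i - m by ring]

instance : CommRing (Analytic C) :=
  { (inferInstance : AddCommGroup (Analytic C)), (inferInstance : Mul (Analytic C)),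
    (inferInstance : One (Analytic C)) with
    mul_assoc := Analytic.mul_assoc
    mul_comm := Analytic.mul_comm
    one_mul := Analytic.one_mul
    mul_one := fun f => by rw [Analytic.mul_comm, Analytic.one_mul]
    left_distrib := Analytic.mul_add
    right_distrib := fun f g h => by
      rw [Analytic.mul_comm, Analytic.mul_add, Analytic.mul_comm h f, Analytic.mul_comm h g]
    zero_mul := fun f => by ext n; simp [coeff_mul]
    mul_zero := fun f => by ext n; simp [coeff_mul] }

/-- A nonzero Laurent series has a first coefficient of maximal absolute value. -/
theorem exists_dominant (f : Analytic C) (hf : f ≠ 0) :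
    ∃ m : ℤ, f.coeff m ≠ 0 ∧ (∀ n, ‖f.coeff n‖ ≤ ‖f.coeff m‖) ∧
      ∀ n < m, ‖f.coeff n‖ < ‖f.coeff m‖ := by
  obtain ⟨n₀, hn₀⟩ : ∃ n, f.coeff n ≠ 0 := by
    by_contra! h
    exact hf (ext h)
  have h0 : 0 < ‖f.coeff n₀‖ := norm_pos_iff.mpr hn₀
  have hfin : {n | ‖f.coeff n₀‖ ≤ ‖f.coeff n‖}.Finite := by
    have := f.tendsto_coeff_zero.norm.eventually (gt_mem_nhds (by rwa [norm_zero]))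
    rw [eventually_cofinite] at this
    simpa using this
  obtain ⟨m₁, hm₁, hmax⟩ := hfin.exists_maximalFor (fun n => ‖f.coeff n‖) _ ⟨n₀, le_refl ‖f.coeff n₀‖⟩
  have hmax' : ∀ n, ‖f.coeff n‖ ≤ ‖f.coeff m₁‖ := by
    intro n
    by_contra! hn
    have := hmax (show n ∈ {n | ‖f.coeff n₀‖ ≤ ‖f.coeff n‖} from hm₁.trans hn.le) hn.le
    exact absurd hn (not_lt.mpr this)
  have hfin2 : {n | ‖f.coeff n‖ = ‖f.coeff m₁‖}.Finite :=
    hfin.subset (fun n (hn : _ = _) => by simpa [hn] using hm₁)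
  obtain ⟨m, hm, hmin⟩ := hfin2.exists_minimalFor id _ ⟨m₁, rfl⟩
  have hm' : ‖f.coeff m‖ = ‖f.coeff m₁‖ := hm
  refine ⟨m, ?_, fun n => hm' ▸ hmax' n, fun n hn => ?_⟩
  · rw [← norm_pos_iff, hm']; exact h0.trans_le hm₁
  · refine lt_of_le_of_ne (hm' ▸ hmax' n) fun h => ?_
    have : m ≤ n := hmin (show n ∈ {n | ‖f.coeff n‖ = ‖f.coeff m₁‖} from h.trans hm') hn.le
    omega

instance : Nontrivial (Analytic C) :=
  ⟨0, 1, fun h => by simpa [coeff_one] using congrArg (fun f => coeff f 0) h⟩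

instance : NoZeroDivisors (Analytic C) := by
  refine ⟨fun {f g} h => ?_⟩
  by_contra! hcon
  obtain ⟨m, hm0, hm1, hm2⟩ := f.exists_dominant hcon.1
  obtain ⟨l, hl0, hl1, hl2⟩ := g.exists_dominant hcon.2
  have h1 : (f * g).coeff (m + l) = 0 := by rw [h]; rfl
  rw [coeff_mul, (f.summable_conv g (m + l)).tsum_eq_add_tsum_ite m] at h1
  have hpos : 0 < ‖f.coeff m‖ * ‖g.coeff l‖ :=
    mul_pos (norm_pos_iff.mpr hm0) (norm_pos_iff.mpr hl0)
  set t : ℤ → C := fun n => if n = m then 0 else f.coeff n * g.coeff (m + l - n) with ht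
  have hlt : ∀ n, ‖t n‖ < ‖f.coeff m‖ * ‖g.coeff l‖ := by
    intro n
    simp only [ht]
    split_ifs with hn
    · simpa using hpos
    · rw [norm_mul]
      rcases lt_or_gt_of_ne hn with hn | hn
      · exact mul_lt_mul_of_lt_of_le_of_nonneg_of_pos (hm2 n hn) (hl1 _) (norm_nonneg _)
          (norm_pos_iff.mpr hl0)
      · exact (mul_le_mul_of_nonneg_right (hm1 n) (norm_nonneg _)).trans_lt
          (mul_lt_mul_of_pos_left (hl2 _ (by omega)) (norm_pos_iff.mpr hm0))
  have hts : Summable t := by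
    have := (f.summable_conv g (m + l)).update m 0
    refine this.congr fun n => ?_
    simp only [ht, Function.update_apply]
  have := norm_tsum_lt_of_forall_lt t hts hpos hlt
  rw [add_sub_cancel_left, add_comm, add_eq_zero_iff_eq_neg] at h1
  rw [h1, norm_neg, norm_mul] at this
  exact lt_irrefl _ this

instance : IsDomain (Analytic C) := NoZeroDivisors.to_isDomain _

/-- The dilation `f(x) ↦ f(u x)`, for `u ≠ 0`: `∑ a n x ^ n ↦ ∑ (u ^ n * a n) x ^ n`. -/
def dilationHom (u : C) (hu : u ≠ 0) : Analytic C →+* Analytic C where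
  toFun f := ofCoeff (fun n => u ^ n * f.coeff n) (by
    intro r hr
    have h := f.tendsto_coeff (‖u‖ * r) (mul_pos (norm_pos_iff.mpr hu) hr)
    refine h.congr fun n => ?_
    rw [norm_mul, norm_zpow, mul_zpow]; ring)
  map_one' := by
    ext n
    rcases eq_or_ne n 0 with rfl | hn
    · simp [coeff_one]
    · simp [coeff_one, Pi.single_eq_of_ne hn]
  map_mul' f g := by
    ext n
    simp only [coeff_ofCoeff, coeff_mul]
    rw [← tsum_mul_left]
    refine tsum_congr fun i => ?_
    have : u ^ n = u ^ i * u ^ (n - i) := by rw [← zpow_add₀ hu]; congr 1; ring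
    rw [this]; ring
  map_zero' := by ext n; simp
  map_add' f g := by ext n; simp [mul_add]

@[simp] theorem coeff_dilationHom (u : C) (hu : u ≠ 0) (f : Analytic C) (n : ℤ) :
    (dilationHom u hu f).coeff n = u ^ n * f.coeff n := rfl

/-- The dilation `f(x) ↦ f(u x)` as an automorphism. -/
def dilation (u : C) (hu : u ≠ 0) : Analytic C ≃+* Analytic C :=
  RingEquiv.ofRingHom (dilationHom u hu) (dilationHom u⁻¹ (inv_ne_zero hu))
    (by ext f n; simp [zpow_ne_zero n hu])
    (by ext f n; simp [zpow_ne_zero n hu])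

@[simp] theorem coeff_dilation (u : C) (hu : u ≠ 0) (f : Analytic C) (n : ℤ) :
    (dilation u hu f).coeff n = u ^ n * f.coeff n := rfl

/-- The derivation `x d/dx` of the analytic functions on `C*`. -/
def eulerX : Derivation ℤ (Analytic C) (Analytic C) :=
  Derivation.mk' (AddMonoidHom.toIntLinearMap
    { toFun := fun f => ofCoeff (fun n => (n : C) * f.coeff n) (by
        intro r hr
        refine squeeze_zero (fun n => by positivity) (fun n => ?_) (f.tendsto_coeff r hr)
        rw [norm_mul]
        have h1 : ‖(n : C)‖ ≤ 1 := IsUltrametricDist.norm_intCast_le_one C n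
        have h2 : 0 ≤ ‖f.coeff n‖ * r ^ n := by positivity
        nlinarith)
      map_zero' := by ext n; simp
      map_add' := fun f g => by ext n; simp [mul_add] })
    (fun f g => by
      ext n
      change (n : C) * (f * g).coeff n = (f * _ + g * _ : Analytic C).coeff n
      rw [mul_comm g, coeff_add, coeff_mul, coeff_mul, coeff_mul,
        ← (summable_conv _ _ _).tsum_add (summable_conv _ _ _), ← tsum_mul_left]
      refine tsum_congr fun i => ?_
      change (n : C) * _ = f.coeff i * (((n - i : ℤ) : C) * g.coeff (n - i)) +
        (i : C) * f.coeff i * g.coeff (n - i)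
      push_cast
      ring)

@[simp] theorem coeff_eulerX (f : Analytic C) (n : ℤ) :
    (eulerX f).coeff n = (n : C) * f.coeff n := rfl

/-- The coefficientwise action `∑ a n x ^ n ↦ ∑ D (a n) x ^ n` of a derivation `D` of `C` which
does not increase the absolute value; it is the extension of `D` that kills `x`. -/
def mapCoeff (D : Derivation ℤ C C) (hD : ∀ a, ‖D a‖ ≤ ‖a‖) :
    Derivation ℤ (Analytic C) (Analytic C) :=
  Derivation.mk' (AddMonoidHom.toIntLinearMap
    { toFun := fun f => ofCoeff (fun n => D (f.coeff n)) (by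
        intro r hr
        refine squeeze_zero (fun n => by positivity) (fun n => ?_) (f.tendsto_coeff r hr)
        exact mul_le_mul_of_nonneg_right (hD _) (by positivity))
      map_zero' := by ext n; simp
      map_add' := fun f g => by ext n; simp })
    (fun f g => by
      have hc : Continuous D :=
        (AddMonoidHomClass.continuous_of_bound (D : C →ₗ[ℤ] C).toAddMonoidHom 1
          (fun a => by simpa using hD a))
      ext n
      change D ((f * g).coeff n) = (f * _ + g * _ : Analytic C).coeff n
      rw [mul_comm g, coeff_add, coeff_mul, coeff_mul, coeff_mul,
        ← (summable_conv _ _ _).tsum_add (summable_conv _ _ _), (summable_conv f g n).map_tsum D hc]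
      refine tsum_congr fun i => ?_
      change D (f.coeff i * g.coeff (n - i)) = f.coeff i * D (g.coeff (n - i)) +
        D (f.coeff i) * g.coeff (n - i)
      rw [Derivation.leibniz, smul_eq_mul, smul_eq_mul]
      ring)

@[simp] theorem coeff_mapCoeff (D : Derivation ℤ C C) (hD) (f : Analytic C) (n : ℤ) :
    (mapCoeff D hD f).coeff n = D (f.coeff n) := rfl

theorem tendsto_theta (Q r : ℝ) (hQ : 1 < Q) (hr : 0 < r) :
    Tendsto (fun n : ℤ => Q ^ (-(n * (n - 1) / 2)) * r ^ n) cofinite (𝓝 0) := by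
  have hQ0 : 0 < Q := by linarith
  obtain ⟨N, hN⟩ := pow_unbounded_of_one_lt (max r r⁻¹) hQ
  have hr1 : r ≤ Q ^ N := (le_max_left _ _).trans hN.le
  have hr2 : r⁻¹ ≤ Q ^ N := (le_max_right _ _).trans hN.le
  have hrn : ∀ n : ℤ, r ^ n ≤ Q ^ ((N : ℤ) * |n|) := by
    intro n
    rw [zpow_mul, zpow_natCast]
    rcases le_total 0 n with h | h
    · rw [abs_of_nonneg h]
      exact zpow_le_zpow_left₀ h hr.le hr1
    · rw [abs_of_nonpos h, show r ^ n = r⁻¹ ^ (-n) by simp]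
      exact zpow_le_zpow_left₀ (by omega) (by positivity) hr2
  set K : ℤ := (2 * N + 3) ^ 2 with hK
  have hbound : ∀ n : ℤ, Q ^ (-(n * (n - 1) / 2)) * r ^ n ≤ Q ^ K * Q⁻¹ ^ n.natAbs := by
    intro n
    calc _ ≤ Q ^ (-(n * (n - 1) / 2)) * Q ^ ((N : ℤ) * |n|) :=
          mul_le_mul_of_nonneg_left (hrn n) (by positivity)
      _ = Q ^ (-(n * (n - 1) / 2) + (N : ℤ) * |n|) := (zpow_add₀ hQ0.ne' _ _).symm
      _ ≤ Q ^ (K - |n|) := by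
          refine zpow_le_zpow_right₀ hQ.le ?_
          have h1 : n * (n - 1) ≤ 2 * (n * (n - 1) / 2) + 1 := by omega
          have h2 : n ≤ |n| := le_abs_self n
          have h3 : |n| * |n| = n * n := abs_mul_abs_self n
          nlinarith [sq_nonneg (2 * |n| - (2 * N + 3))]
      _ = _ := by
          rw [zpow_sub₀ hQ0.ne', inv_pow, div_eq_mul_inv, ← Int.natCast_natAbs, zpow_natCast]
  have hnat : Tendsto Int.natAbs cofinite atTop := by
    rw [← Nat.cofinite_eq_atTop]
    refine Tendsto.cofinite_of_finite_preimage_singleton fun b => ?_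
    refine (Set.toFinite {(b : ℤ), -(b : ℤ)}).subset fun n hn => ?_
    have : n.natAbs = b := hn
    simp only [Set.mem_insert_iff, Set.mem_singleton_iff]
    omega
  have hlim : Tendsto (fun n : ℤ => Q ^ K * Q⁻¹ ^ n.natAbs) cofinite (𝓝 0) := by
    have := (tendsto_pow_atTop_nhds_zero_of_lt_one (by positivity : 0 ≤ Q⁻¹)
      (inv_lt_one_of_one_lt₀ hQ)).comp hnat
    simpa using this.const_mul (Q ^ K)
  exact squeeze_zero (fun n => by positivity) hbound hlim

/-- The Jacobi theta function `∑ q ^ (-n (n - 1) / 2) x ^ n`, for `|q| > 1`. -/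
def theta (q : C) (hq : 1 < ‖q‖) : Analytic C :=
  ofCoeff (fun n => q ^ (-(n * (n - 1) / 2))) (by
    intro r hr
    simpa only [norm_zpow] using tendsto_theta ‖q‖ r hq hr)

@[simp] theorem coeff_theta (q : C) (hq : 1 < ‖q‖) (n : ℤ) :
    (theta q hq).coeff n = q ^ (-(n * (n - 1) / 2)) := rfl

theorem theta_ne_zero (q : C) (hq : 1 < ‖q‖) : theta q hq ≠ 0 := by
  intro h
  have := congrArg (fun f => coeff f 0) h
  simp at this

theorem dilation_theta (q : C) (hq : 1 < ‖q‖) (hq0 : q ≠ 0) :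
    dilation q hq0 (theta q hq) = monomial 1 q * theta q hq := by
  ext n
  rw [coeff_mul, tsum_eq_single 1]
  · simp only [coeff_dilation, coeff_theta, monomial, coeff_ofCoeff, Pi.single_eq_same]
    rw [← zpow_add₀ hq0, ← zpow_one_add₀ hq0]
    congr 1
    have h1 : Even (n * (n - 1)) := Int.even_mul_pred_self n
    have h2 : Even ((n - 1) * (n - 1 - 1)) := Int.even_mul_pred_self (n - 1)
    obtain ⟨a, ha⟩ := h1
    obtain ⟨b, hb⟩ := h2
    have : (n - 1) * (n - 1 - 1) = n * (n - 1) - 2 * n + 2 := by ring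
    omega
  · intro i hi
    simp [monomial, Pi.single_eq_of_ne hi]

end Analytic
end Analytic

/-! ### Extending derivations to rings of fractions and to tensor products -/

section Derivations

universe u

/-- A derivation `D` of `S`, read as the ring homomorphism `s ↦ f s + f (D s) ε`
to the dual numbers of `T`, for `f : S → T`. -/
def dualHom {S T : Type*} [CommRing S] [CommRing T] (f : S →+* T) (D : Derivation ℤ S S) :
    S →+* TrivSqZeroExt T T where
  toFun s := TrivSqZeroExt.inl (f s) + TrivSqZeroExt.inr (f (D s))
  map_one' := by ext <;> simp
  map_mul' a b := by ext <;> simp [mul_comm]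
  map_zero' := by ext <;> simp
  map_add' a b := by ext <;> simp

/-- The derivation given by a ring homomorphism `s ↦ s + (D s) ε` to the dual numbers. -/
def derivationOfDualHom {S : Type*} [CommRing S] (ψ : S →+* TrivSqZeroExt S S)
    (hψ : ∀ s, (ψ s).fst = s) : Derivation ℤ S S :=
  Derivation.mk' (AddMonoidHom.toIntLinearMap
    { toFun := fun s => (ψ s).snd
      map_zero' := by simp
      map_add' := fun a b => by simp })
    (fun a b => by simp [hψ, mul_comm])

theorem derivationOfDualHom_apply {S : Type*} [CommRing S] (ψ : S →+* TrivSqZeroExt S S)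
    (hψ : ∀ s, (ψ s).fst = s) (s : S) : derivationOfDualHom ψ hψ s = (ψ s).snd := rfl

section Fractions

variable {R : Type*} [CommRing R] (S : Type*) [CommRing S] [Algebra R S] [IsFractionRing R S]

/-- The dual-number homomorphism of `fractionDerivation`. -/
def fractionDualHom (D : Derivation ℤ R R) : S →+* TrivSqZeroExt S S :=
  IsLocalization.lift (M := nonZeroDivisors R) (S := S) (g := dualHom (algebraMap R S) D)
    (fun s => by
      rw [TrivSqZeroExt.isUnit_iff_isUnit_fst]
      simpa [dualHom] using IsLocalization.map_units S s)

theorem fractionDualHom_algebraMap (D : Derivation ℤ R R) (r : R) :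
    fractionDualHom S D (algebraMap R S r) = dualHom (algebraMap R S) D r :=
  IsLocalization.lift_eq _ _

/-- The extension of a derivation of `R` to its total ring of fractions `S`
(the quotient rule). -/
def fractionDerivation (D : Derivation ℤ R R) : Derivation ℤ S S :=
  derivationOfDualHom (fractionDualHom S D) (fun s => by
    have : (TrivSqZeroExt.fstHom S S S).toRingHom.comp (fractionDualHom S D) = RingHom.id _ := by
      refine IsLocalization.ringHom_ext (nonZeroDivisors R) ?_
      ext r
      simp [fractionDualHom_algebraMap, dualHom]
    exact congrArg (fun g => g s) this)

@[simp] theorem fractionDerivation_algebraMap (D : Derivation ℤ R R) (r : R) :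
    fractionDerivation S D (algebraMap R S r) = algebraMap R S (D r) := by
  change (fractionDualHom S D (algebraMap R S r)).snd = _
  rw [fractionDualHom_algebraMap]
  change TrivSqZeroExt.snd (TrivSqZeroExt.inl (algebraMap R S r) +
    TrivSqZeroExt.inr (algebraMap R S (D r))) = _
  rw [TrivSqZeroExt.snd_add, TrivSqZeroExt.snd_inl, TrivSqZeroExt.snd_inr, zero_add]

variable {S}

/-- Additive maps which satisfy a common twisted Leibniz rule and agree on the numerators agree. -/
theorem fraction_ext (R : Type*) [CommRing R] [Algebra R S] [IsFractionRing R S] (σ : S →+* S)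
    {D E : S → S}
    (hD : ∀ a b, D (a * b) = σ a * D b + σ b * D a) (hE : ∀ a b, E (a * b) = σ a * E b + σ b * E a)
    (h : ∀ r : R, D (algebraMap R S r) = E (algebraMap R S r)) (y : S) : D y = E y := by
  obtain ⟨⟨r, s⟩, hy⟩ := IsLocalization.surj (nonZeroDivisors R) y
  have hs := (IsLocalization.map_units S s).map σ
  have h1 := congrArg D hy
  have h2 := congrArg E hy
  simp only [hD, hE] at h1 h2
  rw [h, h] at h1
  refine hs.mul_left_cancel ?_
  linear_combination h1 - h2

end Fractions

section Tensor

variable (R A B : Type*) [CommRing R] [CommRing A] [CommRing B] [Algebra R A] [Algebra R B]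

/-- The ring `A ⊗[R] B`. -/
def TensorRing : Type _ := A ⊗[R] B

namespace TensorRing

instance : CommRing (TensorRing R A B) := inferInstanceAs (CommRing (A ⊗[R] B))

variable {A} in
/-- The map `a ↦ a ⊗ 1`. -/
def inl : A →+* TensorRing R A B :=
  (Algebra.TensorProduct.includeLeft : A →ₐ[R] A ⊗[R] B).toRingHom

variable {B} in
/-- The map `b ↦ 1 ⊗ b`. -/
def inr : B →+* TensorRing R A B :=
  (Algebra.TensorProduct.includeRight : B →ₐ[R] A ⊗[R] B).toRingHom

variable {R A B}

theorem inl_algebraMap (r : R) :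
    (inl R B (algebraMap R A r) : TensorRing R A B) = inr R A (algebraMap R B r) :=
  ((Algebra.TensorProduct.includeLeft : A →ₐ[R] A ⊗[R] B).commutes r).trans
    ((Algebra.TensorProduct.includeRight : B →ₐ[R] A ⊗[R] B).commutes r).symm

@[elab_as_elim]
theorem induction {p : TensorRing R A B → Prop} (x : TensorRing R A B) (zero : p 0)
    (mul : ∀ a b, p (inl R B a * inr R A b)) (add : ∀ x y, p x → p y → p (x + y)) : p x := by
  refine TensorProduct.induction_on (motive := p) x zero (fun a b => ?_) add
  have : (inl R B a * inr R A b : TensorRing R A B) = (a ⊗ₜ[R] b : A ⊗[R] B) := by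
    change (a ⊗ₜ[R] 1 : A ⊗[R] B) * (1 ⊗ₜ[R] b : A ⊗[R] B) = _
    simp
  exact this ▸ mul a b

/-- The ring homomorphism out of `A ⊗[R] B` given by two ring homomorphisms that agree on `R`. -/
def lift {S : Type*} [CommRing S] (f : A →+* S) (g : B →+* S)
    (h : ∀ r, f (algebraMap R A r) = g (algebraMap R B r)) : TensorRing R A B →+* S :=
  letI : Algebra R S := (f.comp (algebraMap R A)).toAlgebra
  (Algebra.TensorProduct.lift (S := R) ({ f with commutes' := fun _ => rfl } : A →ₐ[R] S)
    ({ g with commutes' := fun r => (h r).symm } : B →ₐ[R] S) (fun _ _ => Commute.all _ _)).toRingHom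

@[simp] theorem lift_inl {S : Type*} [CommRing S] (f : A →+* S) (g : B →+* S)
    (h : ∀ r, f (algebraMap R A r) = g (algebraMap R B r)) (a : A) :
    lift f g h (inl R B a) = f a := by
  let : Algebra R S := (f.comp (algebraMap R A)).toAlgebra
  exact (Algebra.TensorProduct.lift_tmul _ _ _ a (1 : B)).trans (by simp)

@[simp] theorem lift_inr {S : Type*} [CommRing S] (f : A →+* S) (g : B →+* S)
    (h : ∀ r, f (algebraMap R A r) = g (algebraMap R B r)) (b : B) :
    lift f g h (inr R A b) = g b := by
  let : Algebra R S := (f.comp (algebraMap R A)).toAlgebra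
  exact (Algebra.TensorProduct.lift_tmul _ _ _ (1 : A) b).trans (by simp)

theorem hom_ext {S : Type*} [CommRing S] {f g : TensorRing R A B →+* S}
    (hl : ∀ a, f (inl R B a) = g (inl R B a)) (hr : ∀ b, f (inr R A b) = g (inr R A b)) :
    f = g := by
  ext x
  induction x using induction with
  | zero => simp
  | mul a b => simp [hl, hr]
  | add x y hx hy => simp [hx, hy]

section

variable (DR : Derivation ℤ R R) (DA : Derivation ℤ A A) (DB : Derivation ℤ B B)
  (hA : ∀ r, DA (algebraMap R A r) = algebraMap R A (DR r))
  (hB : ∀ r, DB (algebraMap R B r) = algebraMap R B (DR r))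

/-- The dual-number homomorphism of `TensorRing.derivation`. -/
def derivationDualHom : TensorRing R A B →+* TrivSqZeroExt (TensorRing R A B) (TensorRing R A B) :=
  lift (dualHom (inl R B) DA) (dualHom (inr R A) DB)
    (fun r => by
      simp only [dualHom, RingHom.coe_mk, MonoidHom.coe_mk, OneHom.coe_mk, hA, hB, inl_algebraMap])

/-- The derivation `a ⊗ b ↦ D a ⊗ b + a ⊗ D b` of `A ⊗[R] B`, for derivations of `A` and `B`
which extend one derivation of `R`. -/
def derivation : Derivation ℤ (TensorRing R A B) (TensorRing R A B) :=
  derivationOfDualHom (derivationDualHom DR DA DB hA hB) (fun s => by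
    have : (TrivSqZeroExt.fstHom (TensorRing R A B) (TensorRing R A B)
        (TensorRing R A B)).toRingHom.comp (derivationDualHom DR DA DB hA hB) = RingHom.id _ := by
      refine hom_ext (fun a => ?_) (fun b => ?_)
      · simp [derivationDualHom, dualHom]
      · simp [derivationDualHom, dualHom]
    exact congrArg (fun g => g s) this)

@[simp] theorem derivation_inl (a : A) :
    derivation DR DA DB hA hB (inl R B a) = inl R B (DA a) := by
  change (derivationDualHom DR DA DB hA hB (inl R B a)).snd = _
  rw [derivationDualHom, lift_inl]
  simp [dualHom]

@[simp] theorem derivation_inr (b : B) :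
    derivation DR DA DB hA hB (inr R A b) = inr R A (DB b) := by
  change (derivationDualHom DR DA DB hA hB (inr R A b)).snd = _
  rw [derivationDualHom, lift_inr]
  simp [dualHom]

end

/-- The automorphism `id ⊗ σ` of `A ⊗[R] B`, for an automorphism `σ` of `B` which fixes `R`. -/
def mapRight (σ : B ≃+* B) (hσ : ∀ r, σ (algebraMap R B r) = algebraMap R B r) :
    TensorRing R A B ≃+* TensorRing R A B :=
  (Algebra.TensorProduct.congr (AlgEquiv.refl : A ≃ₐ[R] A)
    ({ σ with commutes' := hσ } : B ≃ₐ[R] B)).toRingEquiv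

@[simp] theorem mapRight_inl (σ : B ≃+* B) (hσ : ∀ r, σ (algebraMap R B r) = algebraMap R B r)
    (a : A) : mapRight σ hσ (inl R B a) = inl R B a := by
  change (Algebra.TensorProduct.congr _ _) (a ⊗ₜ[R] (1 : B)) = (a ⊗ₜ[R] (1 : B) : A ⊗[R] B)
  simp

@[simp] theorem mapRight_inr (σ : B ≃+* B) (hσ : ∀ r, σ (algebraMap R B r) = algebraMap R B r)
    (b : B) : (mapRight σ hσ (inr R A b) : TensorRing R A B) = inr R A (σ b) := by
  change (Algebra.TensorProduct.congr _ _) ((1 : A) ⊗ₜ[R] b) = ((1 : A) ⊗ₜ[R] σ b : A ⊗[R] B)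
  simp

end TensorRing

end Tensor

end Derivations

section NewtonPuiseux

universe w

variable {C : Type w} [NormedField C] [IsUltrametricDist C] [CompleteSpace C] [IsAlgClosed C]
  [CharZero C]

theorem norm_sum_lt {ι : Type*} (s : Finset ι) (f : ι → C) {B : ℝ} (hB : 0 < B)
    (h : ∀ i ∈ s, ‖f i‖ < B) : ‖∑ i ∈ s, f i‖ < B := by
  rcases s.eq_empty_or_nonempty with rfl | hs
  · simpa using hB
  · obtain ⟨i, hi, hle⟩ := IsUltrametricDist.exists_norm_finsetSum_le_of_nonempty hs f
    exact hle.trans_lt (h i hi)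

theorem norm_eq_of_norm_sub_lt {a b : C} (h : ‖a - b‖ < ‖a‖) : ‖b‖ = ‖a‖ := by
  have h1 : ‖-(a - b)‖ ≠ ‖a‖ := by rw [norm_neg]; exact h.ne
  have := IsUltrametricDist.norm_add_eq_max_of_norm_ne_norm h1
  rw [norm_neg, max_eq_right h.le] at this
  rw [← this]
  congr 1
  ring

theorem exists_mem_norm_lt_one (s : Multiset C) (h : ‖s.prod‖ < 1) : ∃ a ∈ s, ‖a‖ < 1 := by
  induction s using Multiset.induction_on with
  | empty => simp at h
  | cons a s ih =>
    by_cases ha : ‖a‖ < 1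
    · exact ⟨a, Multiset.mem_cons_self a s, ha⟩
    · rw [Multiset.prod_cons, norm_mul] at h
      obtain ⟨b, hb, hb1⟩ := ih (by nlinarith [norm_nonneg s.prod])
      exact ⟨b, Multiset.mem_cons_of_mem hb, hb1⟩

theorem mem_of_isAlgebraic (F : Subfield C) [IsAlgClosed F] (hF : ∀ c ∈ F, c ≠ 0 → ‖c‖ = 1)
    (τ : Multiplicative ℚ →* C) (d : ℝ) (hd : 1 < d)
    (hτ : ∀ r : ℚ, ‖τ (Multiplicative.ofAdd r)‖ = d ^ (r : ℝ))
    (S : Subfield C) (hS : IsClosed (S : Set C)) (hFS : F ≤ S) (hτS : ∀ r, τ r ∈ S)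
    (hgood : ∀ s ∈ S, s ≠ 0 → ∃ c ∈ F, ∃ r : ℚ,
      ‖s - c * τ (Multiplicative.ofAdd r)‖ < ‖s‖)
    (a : C) (ha : IsAlgebraic S a) : a ∈ S := by
  have hd0 : 0 < d := by linarith
  let : NontriviallyNormedField S :=
    { (inferInstance : NormedField S) with
      non_trivial := ⟨⟨τ (Multiplicative.ofAdd 1), hτS _⟩, by
        change 1 < ‖τ (Multiplicative.ofAdd 1)‖
        rw [hτ]; simpa using hd⟩ }
  have : CompleteSpace S := hS.completeSpace_coe
  have : IsUltrametricDist S := inferInstance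
  have hint : IsIntegral S a := ha.isIntegral
  set E := IntermediateField.adjoin S {a} with hE
  have : FiniteDimensional S E := IntermediateField.adjoin.finiteDimensional hint
  have : Algebra.IsAlgebraic S E := inferInstance
  have hnorm : ∀ (σ : E →ₐ[S] C) (x : E), ‖σ x‖ = spectralNorm S E x := by
    intro σ x
    let f : AbsoluteValue E ℝ :=
      { toFun := fun y => ‖σ y‖
        map_mul' := fun y z => by simp
        nonneg' := fun y => norm_nonneg _
        eq_zero' := fun y => by simp
        add_le' := fun y z => by simpa using norm_add_le (σ y) (σ z) }
    refine spectralNorm_unique_field_norm_ext (K := S) (f := f) (fun s => ?_) x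
    change ‖σ (algebraMap S E s)‖ = ‖s‖
    rw [AlgHom.commutes]
    rfl
  have hnorm' : ∀ (σ : E →ₐ[S] C) (x : E), ‖σ x‖ = ‖(x : C)‖ := fun σ x => by
    rw [hnorm, ← hnorm E.val x]; rfl
  have hcard : Fintype.card (E →ₐ[S] C) = Module.finrank S E := AlgHom.card S E C
  set n := Module.finrank S E with hn
  have hn0 : 0 < n := Module.finrank_pos
  -- elements of absolute value one are congruent to elements of `F`
  have happrox : ∀ x : E, ‖(x : C)‖ = 1 → ∃ c ∈ F, ‖(x : C) - c‖ < 1 := by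
    intro x hx
    have hcoeff : ∀ i, ∃ c : F, ‖((minpoly S x).coeff i : C) - c‖ < 1 := by
      intro i
      have hle : ‖(minpoly S x).coeff i‖ ≤ 1 := by
        refine (spectralValue_le_one_iff (minpoly.monic (Algebra.IsIntegral.isIntegral x))).mp ?_ i
        change spectralNorm S E x ≤ 1
        rw [← hnorm E.val x]
        exact hx.le
      replace hle : ‖((minpoly S x).coeff i : C)‖ ≤ 1 := hle
      rcases hle.lt_or_eq with h | h
      · exact ⟨0, by simpa using h⟩
      · obtain ⟨c, hc, r, hr⟩ := hgood _ ((minpoly S x).coeff i).2 (by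
          rw [← norm_pos_iff, h]; exact one_pos)
        have hc0 : c ≠ 0 := by
          rintro rfl
          simp at hr
        have h1 := norm_eq_of_norm_sub_lt hr
        rw [norm_mul, hF c hc hc0, one_mul, hτ, h] at h1
        have hr0 : r = 0 := by
          by_contra hr0
          have hr0' : (r : ℝ) ≠ 0 := by exact_mod_cast hr0
          exact hr0' ((Real.rpow_right_inj hd0 hd.ne').mp (h1.trans (Real.rpow_zero d).symm))
        refine ⟨⟨c, hc⟩, ?_⟩
        rw [hr0, ofAdd_zero, map_one, mul_one, h] at hr
        exact hr
    choose c hc using hcoeff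
    set m := (minpoly S x).natDegree with hm
    have hg : (x : C) ^ m + ∑ i ∈ Finset.range m, ((minpoly S x).coeff i : C) * (x : C) ^ i = 0 := by
      have h1 := minpoly.aeval S x
      rw [(minpoly.monic (Algebra.IsIntegral.isIntegral x) :
        (minpoly S x).Monic).as_sum] at h1
      have h2 := congrArg (fun y : E => (y : C)) h1
      simpa [Polynomial.aeval_def, ← hm, Polynomial.eval₂_finsetSum] using! h2
    set h : F[X] := Polynomial.X ^ m + ∑ i ∈ Finset.range m, Polynomial.C (c i) * Polynomial.X ^ i
      with hh
    have hmonic : h.Monic := by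
      refine Polynomial.monic_X_pow_add ?_
      refine Polynomial.mem_degreeLT.mp (Submodule.sum_mem _ fun i hi =>
        Polynomial.mem_degreeLT.mpr ?_)
      exact (Polynomial.degree_C_mul_X_pow_le i (c i)).trans_lt
        (by exact_mod_cast Finset.mem_range.mp hi)
    have hval : ‖Polynomial.eval₂ F.subtype (x : C) h‖ < 1 := by
      have : Polynomial.eval₂ F.subtype (x : C) h =
          ∑ i ∈ Finset.range m, -((((minpoly S x).coeff i : C) - c i) * (x : C) ^ i) := by
        have h1 : Polynomial.eval₂ F.subtype (x : C) h =
            (x : C) ^ m + ∑ i ∈ Finset.range m, (c i : C) * (x : C) ^ i := by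
          simp [hh, Polynomial.eval₂_finsetSum]
        rw [h1]
        simp only [sub_mul, neg_sub, Finset.sum_sub_distrib]
        linear_combination hg
      rw [this]
      refine norm_sum_lt _ _ one_pos fun i _ => ?_
      rw [norm_neg, norm_mul, norm_pow, hx, one_pow, mul_one]
      exact hc i
    rw [(IsAlgClosed.splits h).eq_prod_roots_of_monic hmonic] at hval
    rw [Polynomial.eval₂_multiset_prod] at hval
    obtain ⟨b, hb, hb1⟩ := exists_mem_norm_lt_one _ hval
    simp only [Multiset.map_map, Multiset.mem_map] at hb
    obtain ⟨γ, -, rfl⟩ := hb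
    exact ⟨γ, γ.2, by simpa using hb1⟩
  -- elements of trace zero vanish
  have htr : ∀ x : E, Algebra.trace S E x = 0 → x = 0 := by
    intro x hx
    by_contra hx0
    have hxC : (x : C) ≠ 0 := by simpa using hx0
    have hN : ‖((Algebra.norm S x : S) : C)‖ = ‖(x : C)‖ ^ n := by
      have := Algebra.norm_eq_prod_embeddings S C x
      change ((Algebra.norm S x : S) : C) = _ at this
      rw [this, norm_prod]
      simp [hnorm', hcard]
    have hN0 : ((Algebra.norm S x : S) : C) ≠ 0 := by
      rw [← norm_pos_iff, hN]
      have := norm_pos_iff.mpr hxC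
      positivity
    obtain ⟨c, hc, r, hcr⟩ := hgood _ (Algebra.norm S x : S).2 hN0
    have hval : ‖(x : C)‖ ^ n = d ^ (r : ℝ) := by
      have h1 := norm_eq_of_norm_sub_lt hcr
      have hc0 : c ≠ 0 := by
        rintro rfl
        simp at hcr
      rw [norm_mul, hF c hc hc0, one_mul, hτ] at h1
      rw [← hN, h1]
    set t : S := ⟨τ (Multiplicative.ofAdd (-(r / n))), hτS _⟩ with ht
    have htn : ‖(t : C)‖ ^ n = d ^ (-(r : ℝ)) := by
      rw [ht]
      change ‖τ (Multiplicative.ofAdd (-(r / n)))‖ ^ n = _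
      rw [hτ, ← Real.rpow_natCast, ← Real.rpow_mul hd0.le]
      congr 1
      push_cast
      field_simp
    have hu : ‖((t • x : E) : C)‖ = 1 := by
      have h1 : ((t • x : E) : C) = (t : C) * (x : C) := rfl
      rw [h1, ← pow_eq_one_iff_of_nonneg (norm_nonneg _) hn0.ne', norm_mul, mul_pow, htn, hval,
        ← Real.rpow_add hd0]
      simp
    obtain ⟨e, he, hue⟩ := happrox _ hu
    have htru : ∑ σ : E →ₐ[S] C, σ (t • x) = 0 := by
      rw [← trace_eq_sum_embeddings, map_smul, hx]
      simp
    have hlt : ‖∑ σ : E →ₐ[S] C, (σ (t • x) - e)‖ < 1 := by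
      refine norm_sum_lt _ _ one_pos fun σ _ => ?_
      have : σ (t • x) - e = σ (t • x - algebraMap S E ⟨e, hFS he⟩) := by
        rw [map_sub, AlgHom.commutes]
        rfl
      rw [this, hnorm']
      exact hue
    rw [Finset.sum_sub_distrib, htru, Finset.sum_const, Finset.card_univ, hcard, nsmul_eq_mul,
      zero_sub, norm_neg] at hlt
    by_cases he0 : e = 0
    · rw [he0, sub_zero, hu] at hue
      exact lt_irrefl _ hue
    · have hn' : (n : C) ≠ 0 := by exact_mod_cast hn0.ne'
      rw [hF _ (F.mul_mem (natCast_mem F n) he) (mul_ne_zero hn' he0)] at hlt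
      exact lt_irrefl _ hlt
  have hfin : (⟨a, IntermediateField.mem_adjoin_simple_self S a⟩ : E) =
      algebraMap S E ((n : S)⁻¹ * Algebra.trace S E ⟨a, IntermediateField.mem_adjoin_simple_self S a⟩) := by
    rw [← sub_eq_zero]
    apply htr
    rw [map_sub, Algebra.trace_algebraMap]
    have : (n : S) ≠ 0 := by exact_mod_cast hn0.ne'
    rw [nsmul_eq_mul, ← hn]
    field_simp
    simp
  have := congrArg (fun x : E => (x : C)) hfin
  change a = ((((n : S)⁻¹ * Algebra.trace S E _ : S)) : C) at this
  rw [this]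
  exact Subtype.mem _

section Puiseux

variable (F : Subfield C) (τ : Multiplicative ℚ →* C)

/-- Evaluation of a finite Puiseux sum `∑ c_r [r]` at `[r] = τ r`. -/
def puiseuxEval : (ℚ →₀ F) →ₗ[F] C :=
  Finsupp.linearCombination F (fun r : ℚ => τ (Multiplicative.ofAdd r))

theorem puiseuxEval_single (r : ℚ) (c : F) :
    puiseuxEval F τ (Finsupp.single r c) = c * τ (Multiplicative.ofAdd r) := by
  simp [puiseuxEval, Subfield.smul_def]

/-- The operator `∑ c_r [r] ↦ ∑ r c_r τ r`. -/
def puiseuxWeight : (ℚ →₀ F) →ₗ[F] C :=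
  Finsupp.linearCombination F (fun r : ℚ => (r : C) * τ (Multiplicative.ofAdd r))

theorem puiseuxWeight_single (r : ℚ) (c : F) :
    puiseuxWeight F τ (Finsupp.single r c) = c * ((r : C) * τ (Multiplicative.ofAdd r)) := by
  simp [puiseuxWeight, Subfield.smul_def]

theorem puiseux_dominant
    (hF : ∀ c ∈ F, c ≠ 0 → ‖c‖ = 1) (d : ℝ) (hd : 1 < d)
    (hτ : ∀ r : ℚ, ‖τ (Multiplicative.ofAdd r)‖ = d ^ (r : ℝ))
    (p : ℚ →₀ F) (hp : p ≠ 0) :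
    ∃ r : ℚ, p r ≠ 0 ∧ ‖puiseuxEval F τ p - p r * τ (Multiplicative.ofAdd r)‖ <
        ‖puiseuxEval F τ p‖ ∧ ‖puiseuxEval F τ p‖ = d ^ (r : ℝ) ∧ ∀ s ∈ p.support, s ≤ r := by
  have hd0 : 0 < d := by linarith
  have hne : p.support.Nonempty := Finsupp.support_nonempty_iff.mpr hp
  set r := p.support.max' hne with hr
  have hrs : r ∈ p.support := Finset.max'_mem _ _
  have hpr : p r ≠ 0 := Finsupp.mem_support_iff.mp hrs
  have hterm : ∀ s ∈ p.support, ‖(p s : C) * τ (Multiplicative.ofAdd s)‖ = d ^ (s : ℝ) := by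
    intro s hs
    rw [norm_mul, hτ, hF _ (p s).2 (by simpa using hs), one_mul]
  have hsum : puiseuxEval F τ p = ∑ s ∈ p.support, (p s : C) * τ (Multiplicative.ofAdd s) := by
    simp [puiseuxEval, Finsupp.linearCombination_apply, Finsupp.sum, Subfield.smul_def]
  have hlt : ‖puiseuxEval F τ p - p r * τ (Multiplicative.ofAdd r)‖ < d ^ (r : ℝ) := by
    rw [hsum, ← Finset.add_sum_erase _ _ hrs, add_sub_cancel_left]
    refine norm_sum_lt _ _ (by positivity) fun s hs => ?_
    rw [hterm s (Finset.mem_of_mem_erase hs)]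
    refine Real.rpow_lt_rpow_of_exponent_lt hd ?_
    exact_mod_cast lt_of_le_of_ne (Finset.le_max' _ _ (Finset.mem_of_mem_erase hs))
      (Finset.ne_of_mem_erase hs)
  have hnorm : ‖puiseuxEval F τ p‖ = d ^ (r : ℝ) := by
    rw [← hterm r hrs]
    rw [← norm_neg, neg_sub, ← hterm r hrs] at hlt
    exact norm_eq_of_norm_sub_lt hlt
  exact ⟨r, hpr, hnorm ▸ hlt, hnorm, fun s hs => Finset.le_max' _ _ hs⟩

theorem norm_puiseuxWeight_le
    (hF : ∀ c ∈ F, c ≠ 0 → ‖c‖ = 1) (d : ℝ) (hd : 1 < d)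
    (hτ : ∀ r : ℚ, ‖τ (Multiplicative.ofAdd r)‖ = d ^ (r : ℝ))
    (p : ℚ →₀ F) : ‖puiseuxWeight F τ p‖ ≤ 1 * ‖puiseuxEval F τ p‖ := by
  rw [one_mul]
  have hd0 : 0 < d := by linarith
  by_cases hp : p = 0
  · simp [hp]
  obtain ⟨r, -, -, hnorm, hmax⟩ := puiseux_dominant F τ hF d hd hτ p hp
  have hsum : puiseuxWeight F τ p =
      ∑ s ∈ p.support, (p s : C) * ((s : C) * τ (Multiplicative.ofAdd s)) := by
    simp [puiseuxWeight, Finsupp.linearCombination_apply, Finsupp.sum, Subfield.smul_def]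
  rw [hsum, hnorm]
  refine IsUltrametricDist.norm_sum_le_of_forall_le_of_nonneg (by positivity) fun s hs => ?_
  rw [norm_mul, norm_mul, hτ, hF _ (p s).2 (by simpa using hs), one_mul]
  have h1 : ‖(s : C)‖ ≤ 1 := by
    by_cases h0 : (s : C) = 0
    · simp [h0]
    · exact (hF _ (SubfieldClass.ratCast_mem F s) h0).le
  have h2 : d ^ (s : ℝ) ≤ d ^ (r : ℝ) :=
    Real.rpow_le_rpow_of_exponent_le hd.le (by exact_mod_cast hmax s hs)
  have h3 : 0 < d ^ (s : ℝ) := by positivity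
  nlinarith

end Puiseux

section Density

variable (F : Subfield C) [IsAlgClosed F] (τ : Multiplicative ℚ →* C)

/-- The ring of finite Puiseux sums. -/
def puiseuxRing : Subring C where
  carrier := Set.range (puiseuxEval F τ)
  zero_mem' := ⟨0, by simp⟩
  one_mem' := ⟨Finsupp.single 0 1, by simp [puiseuxEval_single]⟩
  add_mem' := by
    rintro _ _ ⟨p, rfl⟩ ⟨p', rfl⟩
    exact ⟨p + p', by simp⟩
  neg_mem' := by
    rintro _ ⟨p, rfl⟩
    exact ⟨-p, by simp⟩
  mul_mem' := by
    rintro _ _ ⟨p, rfl⟩ ⟨p', rfl⟩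
    induction p using Finsupp.induction_linear with
    | zero => exact ⟨0, by simp⟩
    | add x y hx hy =>
      obtain ⟨a, ha⟩ := hx
      obtain ⟨b, hb⟩ := hy
      exact ⟨a + b, by simp [ha, hb, add_mul]⟩
    | single r c =>
      induction p' using Finsupp.induction_linear with
      | zero => exact ⟨0, by simp⟩
      | add x y hx hy =>
        obtain ⟨a, ha⟩ := hx
        obtain ⟨b, hb⟩ := hy
        exact ⟨a + b, by simp [ha, hb, mul_add]⟩
      | single r' c' =>
        refine ⟨Finsupp.single (r + r') (c * c'), ?_⟩
        simp only [puiseuxEval_single, ofAdd_add, map_mul, Subfield.coe_mul]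
        ring

theorem puiseux_good
    (hF : ∀ c ∈ F, c ≠ 0 → ‖c‖ = 1) (d : ℝ) (hd : 1 < d)
    (hτ : ∀ r : ℚ, ‖τ (Multiplicative.ofAdd r)‖ = d ^ (r : ℝ))
    (s : C) (hs : s ∈ (puiseuxRing F τ).topologicalClosure) (hs0 : s ≠ 0) :
    ∃ c ∈ F, ∃ r : ℚ, ‖s - c * τ (Multiplicative.ofAdd r)‖ < ‖s‖ := by
  have h1 : s ∈ closure (Set.range (puiseuxEval F τ)) := hs
  rw [Metric.mem_closure_iff] at h1
  obtain ⟨_, ⟨p, rfl⟩, hp⟩ := h1 ‖s‖ (norm_pos_iff.mpr hs0)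
  rw [dist_eq_norm] at hp
  have hn := norm_eq_of_norm_sub_lt hp
  have hp0 : p ≠ 0 := by
    rintro rfl
    simp at hp
  obtain ⟨r, -, hr, -, -⟩ := puiseux_dominant F τ hF d hd hτ p hp0
  refine ⟨p r, (p r).2, r, ?_⟩
  rw [hn] at hr
  have : s - p r * τ (Multiplicative.ofAdd r) =
    (s - puiseuxEval F τ p) + (puiseuxEval F τ p - p r * τ (Multiplicative.ofAdd r)) := by ring
  rw [this]
  exact (IsUltrametricDist.norm_add_le_max _ _).trans_lt (max_lt hp hr)

theorem puiseux_inv_mem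
    (hF : ∀ c ∈ F, c ≠ 0 → ‖c‖ = 1) (d : ℝ) (hd : 1 < d)
    (hτ : ∀ r : ℚ, ‖τ (Multiplicative.ofAdd r)‖ = d ^ (r : ℝ))
    (s : C) (hs : s ∈ (puiseuxRing F τ).topologicalClosure) :
    s⁻¹ ∈ (puiseuxRing F τ).topologicalClosure := by
  by_cases hs0 : s = 0
  · simp [hs0]
  obtain ⟨c, hc, r, hr⟩ := puiseux_good F τ hF d hd hτ s hs hs0
  have hn := norm_eq_of_norm_sub_lt hr
  have hc0 : c ≠ 0 := by
    rintro rfl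
    simp at hr
  set P := (puiseuxRing F τ).topologicalClosure with hP
  set v := c * τ (Multiplicative.ofAdd r) with hv
  have hv0 : v ≠ 0 := by
    rw [← norm_pos_iff, hn]
    exact norm_pos_iff.mpr hs0
  have hvinv : v⁻¹ ∈ P := by
    refine (puiseuxRing F τ).le_topologicalClosure ⟨Finsupp.single (-r) ⟨c⁻¹, F.inv_mem hc⟩, ?_⟩
    rw [puiseuxEval_single]
    refine eq_inv_of_mul_eq_one_left ?_
    rw [hv]
    calc c⁻¹ * τ (Multiplicative.ofAdd (-r)) * (c * τ (Multiplicative.ofAdd r))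
        = (c⁻¹ * c) * τ (Multiplicative.ofAdd (-r) * Multiplicative.ofAdd r) := by
          rw [map_mul]; ring
      _ = 1 := by
          rw [inv_mul_cancel₀ hc0, ← ofAdd_add]
          simp
  have hlt : ‖1 - s * v⁻¹‖ < 1 := by
    have : 1 - s * v⁻¹ = -(s - v) * v⁻¹ := by field_simp; ring
    rw [this, norm_mul, norm_neg, norm_inv, hn, ← div_eq_mul_inv,
      div_lt_one (norm_pos_iff.mpr hs0)]
    exact hr
  have hw : 1 - s * v⁻¹ ∈ P := P.sub_mem P.one_mem (P.mul_mem hs hvinv)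
  have hgeo := (hasSum_geometric_of_norm_lt_one hlt).tendsto_sum_nat
  rw [sub_sub_cancel] at hgeo
  have hmem : (s * v⁻¹)⁻¹ ∈ P := by
    refine (puiseuxRing F τ).isClosed_topologicalClosure.mem_of_tendsto hgeo
      (Eventually.of_forall fun n => ?_)
    exact P.sum_mem fun i _ => P.pow_mem hw i
  have : s⁻¹ = (s * v⁻¹)⁻¹ * v⁻¹ := by
    field_simp
  rw [this]
  exact P.mul_mem hmem hvinv

/-- The finite Puiseux sums are dense, if no proper closed algebraically closed subfield contains
the subfield `K`, which is algebraic over the field generated by `F` and `τ 1`. -/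
theorem dense_puiseuxEval
    (hF : ∀ c ∈ F, c ≠ 0 → ‖c‖ = 1) (d : ℝ) (hd : 1 < d)
    (hτ : ∀ r : ℚ, ‖τ (Multiplicative.ofAdd r)‖ = d ^ (r : ℝ))
    (K : Set C)
    (hK : ∀ S : Subfield C, F ≤ S → τ (Multiplicative.ofAdd 1) ∈ S → ∀ x ∈ K, IsAlgebraic S x)
    (hmin : ∀ S : Subfield C, IsClosed (S : Set C) → IsAlgClosed S → K ⊆ S → S = ⊤) :
    DenseRange (puiseuxEval F τ) := by
  set S : Subfield C := { (puiseuxRing F τ).topologicalClosure with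
    inv_mem' := puiseux_inv_mem F τ hF d hd hτ } with hS
  have hSc : IsClosed (S : Set C) := (puiseuxRing F τ).isClosed_topologicalClosure
  have hFS : F ≤ S := fun c hc => (puiseuxRing F τ).le_topologicalClosure
    ⟨Finsupp.single 0 ⟨c, hc⟩, by simp [puiseuxEval_single]⟩
  have hτS : ∀ r, τ r ∈ S := fun r => (puiseuxRing F τ).le_topologicalClosure
    ⟨Finsupp.single (Multiplicative.toAdd r) 1, by simp [puiseuxEval_single]⟩
  have halg : ∀ a : C, IsAlgebraic S a → a ∈ S :=
    mem_of_isAlgebraic F hF τ d hd hτ S hSc hFS hτS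
      (fun s hs hs0 => puiseux_good F τ hF d hd hτ s hs hs0)
  have hcl : IsAlgClosed S := by
    refine IsAlgClosed.of_exists_root _ fun p hp hirr => ?_
    have hdeg : p.degree ≠ 0 := (Polynomial.degree_pos_of_irreducible hirr).ne'
    obtain ⟨x, hx⟩ := IsAlgClosed.exists_aeval_eq_zero C p hdeg
    have hxS := halg x ⟨p, hp.ne_zero, hx⟩
    refine ⟨⟨x, hxS⟩, ?_⟩
    have h1 : Polynomial.aeval (algebraMap S C ⟨x, hxS⟩) p = 0 := hx
    rw [Polynomial.aeval_algebraMap_apply] at h1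
    have h2 : Polynomial.aeval (⟨x, hxS⟩ : S) p = 0 := Subtype.ext h1
    simpa using h2
  have htop : S = ⊤ := hmin S hSc hcl (fun x hx => halg x (hK S hFS (hτS _) x hx))
  intro x
  have : x ∈ S := by rw [htop]; trivial
  exact this

theorem exists_weightDerivation
    (hF : ∀ c ∈ F, c ≠ 0 → ‖c‖ = 1) (d : ℝ) (hd : 1 < d)
    (hτ : ∀ r : ℚ, ‖τ (Multiplicative.ofAdd r)‖ = d ^ (r : ℝ))
    (hdense : DenseRange (puiseuxEval F τ)) :
    ∃ D : Derivation ℤ C C, (∀ a, ‖D a‖ ≤ ‖a‖) ∧ (∀ c ∈ F, D c = 0) ∧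
      ∀ r : ℚ, D (τ (Multiplicative.ofAdd r)) = r * τ (Multiplicative.ofAdd r) := by
  have hb := norm_puiseuxWeight_le F τ hF d hd hτ
  have : IsBoundedSMul F C := IsBoundedSMul.of_norm_smul_le fun c x => by
    rw [Subfield.smul_def, smul_eq_mul, norm_mul]
    rfl
  set D₀ : C →L[F] C := (puiseuxWeight F τ).extendOfNorm (puiseuxEval F τ) with hD₀
  have heq : ∀ p, D₀ (puiseuxEval F τ p) = puiseuxWeight F τ p :=
    LinearMap.extendOfNorm_eq hdense ⟨1, hb⟩
  have hmul : ∀ a b, D₀ (a * b) = a * D₀ b + b * D₀ a := by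
    intro a b
    refine hdense.induction_on₂ (p := fun a b => D₀ (a * b) = a * D₀ b + b * D₀ a)
      (isClosed_eq (by fun_prop) (by fun_prop)) ?_ a b
    intro p p'
    induction p using Finsupp.induction_linear with
    | zero => simp
    | add x y hx hy => rw [map_add, add_mul, map_add, map_add, hx, hy]; ring
    | single r c =>
      induction p' using Finsupp.induction_linear with
      | zero => simp
      | add x y hx hy => rw [map_add, mul_add, map_add, map_add, hx, hy]; ring
      | single r' c' =>
        have h1 : puiseuxEval F τ (Finsupp.single r c) * puiseuxEval F τ (Finsupp.single r' c') =
            puiseuxEval F τ (Finsupp.single (r + r') (c * c')) := by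
          simp only [puiseuxEval_single, ofAdd_add, map_mul, Subfield.coe_mul]
          ring
        rw [h1, heq, heq, heq]
        simp only [puiseuxEval_single, puiseuxWeight_single, ofAdd_add, map_mul, Subfield.coe_mul]
        push_cast
        ring
  refine ⟨Derivation.mk' (D₀ : C →ₗ[F] C).toAddMonoidHom.toIntLinearMap hmul, ?_, ?_, ?_⟩
  · intro a
    change ‖D₀ a‖ ≤ ‖a‖
    simpa using LinearMap.norm_extendOfNorm_apply_le hdense 1 hb a
  · intro c hc
    have := heq (Finsupp.single 0 ⟨c, hc⟩)
    rw [puiseuxEval_single, puiseuxWeight_single] at this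
    change D₀ c = 0
    simpa using this
  · intro r
    have := heq (Finsupp.single r 1)
    rw [puiseuxEval_single, puiseuxWeight_single] at this
    change D₀ (τ (Multiplicative.ofAdd r)) = _
    simpa using this

end Density

end NewtonPuiseux

section Roots

universe w

variable {C : Type w} [NormedField C] [IsAlgClosed C] [CharZero C]

/-- A compatible system of rational powers of `q`. -/
theorem exists_rationalPowers (q : C) (hq : 1 < ‖q‖) :
    ∃ τ : Multiplicative ℚ →* C, τ (Multiplicative.ofAdd 1) = q ∧
      ∀ r : ℚ, ‖τ (Multiplicative.ofAdd r)‖ = ‖q‖ ^ (r : ℝ) := by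
  have hq0 : q ≠ 0 := by
    rintro rfl
    rw [norm_zero] at hq
    linarith
  let : RootableBy Cˣ ℕ := rootableByOfPowLeftSurj Cˣ ℕ (fun {n} hn x => by
    obtain ⟨z, hz⟩ := IsAlgClosed.exists_pow_nat_eq (x : C) (Nat.pos_of_ne_zero hn)
    have hz0 : z ≠ 0 := by
      rintro rfl
      rw [zero_pow hn] at hz
      exact x.ne_zero hz.symm
    exact ⟨Units.mk0 z hz0, Units.ext (by simpa using hz)⟩)
  let : DivisibleBy (Additive Cˣ) ℕ :=
    { div := fun x n => Additive.ofMul (RootableBy.root x.toMul n)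
      div_zero := fun x => congrArg Additive.ofMul (RootableBy.root_zero x.toMul)
      div_cancel := fun {n} x hn => congrArg Additive.ofMul (RootableBy.root_cancel x.toMul hn) }
  let : DivisibleBy (Additive Cˣ) ℤ := AddGroup.divisibleByIntOfDivisibleByNat (Additive Cˣ)
  obtain ⟨t, ht⟩ := (Module.Baer.of_divisible (Additive Cˣ)).extension_property_addMonoidHom
    (Int.castAddHom ℚ) Int.cast_injective
    (zmultiplesHom (Additive Cˣ) (Additive.ofMul (Units.mk0 q hq0)))
  have htz : ∀ n : ℤ, t n = n • Additive.ofMul (Units.mk0 q hq0) := fun n => by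
    have := congrArg (fun f => f n) ht
    simpa using this
  let τ : Multiplicative ℚ →* C := (Units.coeHom C).comp (AddMonoidHom.toMultiplicativeLeft t)
  have hτ : ∀ r : ℚ, τ (Multiplicative.ofAdd r) = ((t r).toMul : Cˣ) := fun r => rfl
  have hτz : ∀ n : ℤ, τ (Multiplicative.ofAdd (n : ℚ)) = q ^ n := fun n => by
    rw [hτ, htz]
    simp
  refine ⟨τ, by simpa using hτz 1, fun r => ?_⟩
  have hden : (0 : ℝ) < r.den := by exact_mod_cast r.den_pos
  have h1 : τ (Multiplicative.ofAdd r) ^ r.den = q ^ r.num := by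
    rw [← hτz, ← map_pow, ← ofAdd_nsmul, nsmul_eq_mul, mul_comm, Rat.mul_den_eq_num]
  have h2 : ‖τ (Multiplicative.ofAdd r)‖ ^ r.den = ‖q‖ ^ r.num := by
    rw [← norm_pow, h1, norm_zpow]
  have hpos : 0 < ‖q‖ := by linarith
  refine (pow_left_inj₀ (norm_nonneg _) (by positivity) r.den_pos.ne').mp ?_
  rw [h2, ← Real.rpow_natCast, ← Real.rpow_mul hpos.le, ← Real.rpow_intCast]
  congr 1
  have : (r : ℝ) * (r.den : ℝ) = (r.num : ℝ) := by exact_mod_cast Rat.mul_den_eq_num r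
  exact this.symm

/-- The elements algebraic over a trivially valued field have absolute value one. -/
theorem norm_eq_one_of_isAlgebraic [IsUltrametricDist C] {k : Type*} [Field k] [Algebra k C]
    (hk : ∀ c : k, c ≠ 0 → ‖algebraMap k C c‖ = 1) (c : C) (hc : IsAlgebraic k c) (hc0 : c ≠ 0) :
    ‖c‖ = 1 := by
  have key : ∀ c : C, IsAlgebraic k c → ‖c‖ ≤ 1 := by
    intro c hc
    by_contra! h
    set p := minpoly k c with hp
    have hm : p.Monic := minpoly.monic hc.isIntegral
    have hdeg : 0 < p.natDegree := minpoly.natDegree_pos hc.isIntegral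
    have h1 := minpoly.aeval k c
    rw [← hp, hm.as_sum] at h1
    have h2 : c ^ p.natDegree = -∑ i ∈ Finset.range p.natDegree,
        algebraMap k C (p.coeff i) * c ^ i := by
      rw [eq_neg_iff_add_eq_zero]
      simpa [Polynomial.aeval_def, Polynomial.eval₂_finsetSum] using h1
    have h3 : ‖c ^ p.natDegree‖ ≤ ‖c‖ ^ (p.natDegree - 1) := by
      rw [h2, norm_neg]
      refine IsUltrametricDist.norm_sum_le_of_forall_le_of_nonneg (by positivity) fun i hi => ?_
      rw [norm_mul, norm_pow]
      have h4 : ‖algebraMap k C (p.coeff i)‖ ≤ 1 := by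
        by_cases h0 : p.coeff i = 0
        · simp [h0]
        · exact (hk _ h0).le
      have h5 : ‖c‖ ^ i ≤ ‖c‖ ^ (p.natDegree - 1) :=
        pow_le_pow_right₀ h.le (by have := Finset.mem_range.mp hi; omega)
      have h6 : 0 ≤ ‖c‖ ^ i := by positivity
      nlinarith
    rw [norm_pow] at h3
    have h7 : ‖c‖ ^ (p.natDegree - 1) < ‖c‖ ^ p.natDegree := pow_lt_pow_right₀ h (by omega)
    linarith
  refine le_antisymm (key c hc) ?_
  have := key c⁻¹ hc.inv
  rw [norm_inv] at this
  exact (inv_le_one₀ (norm_pos_iff.mpr hc0)).mp this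

end Roots

/-! ### The field `C` and the derivation `δ_q = q d/dq` of `C` -/

section Setting

universe u v w

variable (k : Type u) (K : Type v) (C : Type w) [Field k] [CharZero k]
  [NormedField K] [Algebra (RatFunc k) K]
  [NormedField C] [NormedAlgebra K C] [IsUltrametricDist C] [CompleteSpace C] [IsAlgClosed C]

/-- The base fields: `K` is a finite extension of the field `k(q)` of rational functions
(`RatFunc k`), its absolute value extends the absolute value `|f| = d ^ deg f` of `k[q]`, `d > 1`,
and `C` is a smallest complete and algebraically closed valued extension of `K`. -/
class BaseSetting : Prop where
  finite : FiniteDimensional (RatFunc k) K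
  exists_base : ∃ d : ℝ, 1 < d ∧ ∀ f : k[X], f ≠ 0 →
    ‖algebraMap (RatFunc k) K (algebraMap k[X] (RatFunc k) f)‖ = d ^ f.natDegree
  eq_top : ∀ S : Subfield C, IsClosed (S : Set C) → IsAlgClosed S →
    Set.range (algebraMap K C) ⊆ S → S = ⊤

/-- The embedding of `k(q)` into `C`. -/
def ratFuncHom : RatFunc k →+* C := (algebraMap K C).comp (algebraMap (RatFunc k) K)

/-- The element `q` of `C`. -/
def qElt : C := ratFuncHom k K C RatFunc.X

variable [BaseSetting k K C]

theorem one_lt_norm_qElt : 1 < ‖qElt k K C‖ := by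
  obtain ⟨d, hd, h⟩ := BaseSetting.exists_base (k := k) (K := K) C
  have := h Polynomial.X Polynomial.X_ne_zero
  rw [qElt, ratFuncHom, RingHom.comp_apply, norm_algebraMap', ← RatFunc.algebraMap_X, this]
  simpa using hd

theorem qElt_ne_zero : qElt k K C ≠ 0 :=
  norm_pos_iff.mp (zero_lt_one.trans (one_lt_norm_qElt k K C))

/-- There is a derivation of `C` which does not increase the absolute value and extends the
derivation `q d/dq` of `k(q)`. -/
theorem exists_deltaQ : ∃ D : Derivation ℤ C C, (∀ a, ‖D a‖ ≤ ‖a‖) ∧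
    ∀ f : k[X], D (ratFuncHom k K C (algebraMap k[X] (RatFunc k) f)) =
      ratFuncHom k K C (algebraMap k[X] (RatFunc k) (Polynomial.X * Polynomial.derivative f)) := by
  obtain ⟨d, hd, h⟩ := BaseSetting.exists_base (k := k) (K := K) C
  let κ : k →+* C := (ratFuncHom k K C).comp ((algebraMap k[X] (RatFunc k)).comp Polynomial.C)
  let : Algebra k C := κ.toAlgebra
  have : CharZero C := charZero_of_injective_algebraMap κ.injective
  have hκ : ∀ c : k, c ≠ 0 → ‖algebraMap k C c‖ = 1 := by
    intro c hc
    have := h (Polynomial.C c) (by simpa using hc)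
    change ‖algebraMap K C (algebraMap (RatFunc k) K (algebraMap k[X] (RatFunc k)
      (Polynomial.C c)))‖ = 1
    rw [norm_algebraMap', this]
    simp
  let F : Subfield C := (algebraicClosure k C).toSubfield
  have : IsAlgClosed F := (algebraicClosure.isAlgClosure (F := k) (E := C)).isAlgClosed
  have hF : ∀ c ∈ F, c ≠ 0 → ‖c‖ = 1 := fun c hc hc0 =>
    norm_eq_one_of_isAlgebraic hκ c (mem_algebraicClosure_iff.mp hc) hc0
  have hkF : ∀ c : k, κ c ∈ F := fun c => (algebraicClosure k C).algebraMap_mem c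
  obtain ⟨τ, hτ1, hτ⟩ := exists_rationalPowers (qElt k K C) (one_lt_norm_qElt k K C)
  have hdense : DenseRange (puiseuxEval F τ) := by
    refine dense_puiseuxEval F τ hF ‖qElt k K C‖ (one_lt_norm_qElt k K C) hτ
      (Set.range (algebraMap K C)) ?_ (BaseSetting.eq_top k)
    rintro S hFS hqS _ ⟨x, rfl⟩
    have hrange : ∀ g : RatFunc k, ratFuncHom k K C g ∈ S := by
      have hpoly : ∀ f : k[X], ratFuncHom k K C (algebraMap k[X] (RatFunc k) f) ∈ S := by
        intro f
        induction f using Polynomial.induction_on' with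
        | add p p' hp hp' => rw [map_add, map_add]; exact S.add_mem hp hp'
        | monomial n a =>
          rw [← Polynomial.C_mul_X_pow_eq_monomial, map_mul, map_mul, map_pow, map_pow,
            RatFunc.algebraMap_X]
          exact S.mul_mem (hFS (hkF a)) (S.pow_mem (by rw [hτ1] at hqS; exact hqS) n)
      intro g
      rw [← RatFunc.num_div_denom g, map_div₀]
      exact S.div_mem (hpoly _) (hpoly _)
    have := BaseSetting.finite (k := k) (K := K) C
    obtain ⟨p, hp0, hp⟩ := Algebra.IsAlgebraic.isAlgebraic (R := RatFunc k) x
    let g : RatFunc k →+* S := (ratFuncHom k K C).codRestrict S hrange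
    refine ⟨p.map g, (Polynomial.map_ne_zero_iff g.injective).mpr hp0, ?_⟩
    rw [Polynomial.aeval_def, Polynomial.eval₂_map]
    have h1 : (algebraMap S C).comp g = (algebraMap K C).comp (algebraMap (RatFunc k) K) := rfl
    rw [h1, ← Polynomial.hom_eval₂, ← Polynomial.aeval_def, hp, map_zero]
  obtain ⟨D, hD1, hD2, hD3⟩ := exists_weightDerivation F τ hF ‖qElt k K C‖
    (one_lt_norm_qElt k K C) hτ hdense
  refine ⟨D, hD1, fun f => ?_⟩
  have hDq : D (qElt k K C) = qElt k K C := by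
    have := hD3 1
    rw [hτ1] at this
    simpa using this
  induction f using Polynomial.induction_on' with
  | add p p' hp hp' => simp only [map_add, mul_add, hp, hp']
  | monomial n a =>
    have h1 : ∀ (m : ℕ) (b : k), ratFuncHom k K C (algebraMap k[X] (RatFunc k)
        (Polynomial.monomial m b)) = κ b * qElt k K C ^ m := by
      intro m b
      rw [← Polynomial.C_mul_X_pow_eq_monomial, map_mul, map_mul, map_pow, map_pow,
        RatFunc.algebraMap_X]
      rfl
    rw [Polynomial.derivative_monomial, Polynomial.X_mul_monomial, h1, h1, Derivation.leibniz,
      hD2 _ (hkF a), Derivation.leibniz_pow, hDq]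
    rcases n with _ | n
    · simp
    · simp only [smul_eq_mul, map_mul, map_natCast, mul_zero, add_zero, nsmul_eq_mul,
        Nat.add_sub_cancel]
      ring

/-- The derivation `δ_q = q d/dq` of `C`: the continuous derivation of `C` which extends the
derivation `q d/dq` of `k(q)`. It is unique, because the elements of `C` on which two continuous
extensions agree form a closed algebraically closed subfield which contains `K`. -/
def deltaQ : Derivation ℤ C C := (exists_deltaQ k K C).choose

theorem norm_deltaQ_le (a : C) : ‖deltaQ k K C a‖ ≤ ‖a‖ := (exists_deltaQ k K C).choose_spec.1 a

theorem deltaQ_polynomial (f : k[X]) :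
    deltaQ k K C (ratFuncHom k K C (algebraMap k[X] (RatFunc k) f)) =
      ratFuncHom k K C (algebraMap k[X] (RatFunc k) (Polynomial.X * Polynomial.derivative f)) :=
  (exists_deltaQ k K C).choose_spec.2 f

theorem deltaQ_qElt : deltaQ k K C (qElt k K C) = qElt k K C := by
  have := deltaQ_polynomial k K C Polynomial.X
  rw [Polynomial.derivative_X, mul_one, RatFunc.algebraMap_X] at this
  exact this

end Setting

/-! ### Meromorphic functions and elliptic functions -/

section Meromorphic

universe u v w

/-- The field of meromorphic functions on `C*`: the field of fractions of the ring of analytic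
functions. -/
def Mer (C : Type w) [NormedField C] [IsUltrametricDist C] [CompleteSpace C] : Type w :=
  FractionRing (Analytic C)

section

variable (C : Type w) [NormedField C] [IsUltrametricDist C] [CompleteSpace C]

instance : Field (Mer C) := inferInstanceAs (Field (FractionRing (Analytic C)))
instance : Algebra (Analytic C) (Mer C) :=
  inferInstanceAs (Algebra (Analytic C) (FractionRing (Analytic C)))
instance : IsFractionRing (Analytic C) (Mer C) :=
  inferInstanceAs (IsFractionRing (Analytic C) (FractionRing (Analytic C)))

/-- The derivation `δ_x = x d/dx` of the field of meromorphic functions. -/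
def deltaX : Derivation ℤ (Mer C) (Mer C) := 
  fractionDerivation (Mer C) (Analytic.eulerX : Derivation ℤ (Analytic C) (Analytic C))

end

variable (k : Type u) (K : Type v) (C : Type w) [Field k] [CharZero k]
  [NormedField K] [Algebra (RatFunc k) K]
  [NormedField C] [NormedAlgebra K C] [IsUltrametricDist C] [CompleteSpace C] [IsAlgClosed C]
  [BaseSetting k K C]

/-- The action of `δ_q` on the field of meromorphic functions, with `δ_q x = 0`. -/
def deltaQMer : Derivation ℤ (Mer C) (Mer C) :=
  fractionDerivation (Mer C) (Analytic.mapCoeff (deltaQ k K C) (norm_deltaQ_le k K C))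

/-- The `q`-difference operator `σ_q : f(x) ↦ f(q x)` of the field of meromorphic functions. -/
def sigmaQ : Mer C ≃+* Mer C :=
  IsFractionRing.ringEquivOfRingEquiv (Analytic.dilation (qElt k K C) (qElt_ne_zero k K C))

/-- The Jacobi theta function `θ_q`, as a meromorphic function. -/
def thetaQ : Mer C :=
  algebraMap (Analytic C) (Mer C) (Analytic.theta (qElt k K C) (one_lt_norm_qElt k K C))

/-- The logarithmic derivative `ℓ_q = δ_x(θ_q) / θ_q`. -/
def ellQ : Mer C := deltaX C (thetaQ k K C) / thetaQ k K C

/-- The derivation `δ = ℓ_q δ_x + δ_q` of the field of meromorphic functions. -/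
def delta : Derivation ℤ (Mer C) (Mer C) := ellQ k K C • deltaX C + deltaQMer k K C

theorem sigmaQ_algebraMap (f : Analytic C) :
    sigmaQ k K C (algebraMap (Analytic C) (Mer C) f) = algebraMap (Analytic C) (Mer C)
      (Analytic.dilation (qElt k K C) (qElt_ne_zero k K C) f) :=
  IsFractionRing.ringEquivOfRingEquiv_algebraMap _ _

theorem sigmaQ_deltaX (f : Mer C) :
    sigmaQ k K C (deltaX C f) = deltaX C (sigmaQ k K C f) := by
  refine fraction_ext (Analytic C) (sigmaQ k K C : Mer C →+* Mer C)
    (D := fun f => sigmaQ k K C (deltaX C f)) (E := fun f => deltaX C (sigmaQ k K C f))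
    (fun a b => by simp) (fun a b => by simp) (fun f => ?_) f
  simp only [deltaX, fractionDerivation_algebraMap, sigmaQ_algebraMap]
  congr 1
  ext n
  simp only [Analytic.coeff_dilation, Analytic.coeff_eulerX]
  ring

theorem sigmaQ_deltaQMer (f : Mer C) :
    sigmaQ k K C (deltaX C f) + sigmaQ k K C (deltaQMer k K C f) =
      deltaQMer k K C (sigmaQ k K C f) := by
  refine fraction_ext (Analytic C) (sigmaQ k K C : Mer C →+* Mer C)
    (D := fun f => sigmaQ k K C (deltaX C f) + sigmaQ k K C (deltaQMer k K C f))
    (E := fun f => deltaQMer k K C (sigmaQ k K C f))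
    (fun a b => by simp; ring) (fun a b => by simp) (fun f => ?_) f
  simp only [deltaX, deltaQMer, fractionDerivation_algebraMap, sigmaQ_algebraMap, ← map_add]
  congr 1
  ext n
  have hz : ∀ n : ℤ, deltaQ k K C (qElt k K C ^ n) = n * qElt k K C ^ n := by
    intro n
    rw [Derivation.leibniz_zpow, deltaQ_qElt, smul_eq_mul, zsmul_eq_mul,
      zpow_sub_one₀ (qElt_ne_zero k K C)]
    field_simp [qElt_ne_zero k K C]
  simp only [Analytic.coeff_dilation, Analytic.coeff_eulerX, Analytic.coeff_mapCoeff,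
    Analytic.coeff_add, Derivation.leibniz, smul_eq_mul, hz]
  ring

theorem thetaQ_ne_zero : thetaQ k K C ≠ 0 := by
  rw [thetaQ, Ne, IsFractionRing.to_map_eq_zero_iff]
  exact Analytic.theta_ne_zero _ _

theorem sigmaQ_ellQ : sigmaQ k K C (ellQ k K C) = ellQ k K C + 1 := by
  have hm0 : algebraMap (Analytic C) (Mer C) (Analytic.monomial 1 (qElt k K C)) ≠ 0 := by
    rw [Ne, IsFractionRing.to_map_eq_zero_iff]
    intro h
    have := congrArg (fun f => Analytic.coeff f 1) h
    simp [Analytic.monomial] at this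
    exact qElt_ne_zero k K C this
  have hs : sigmaQ k K C (thetaQ k K C) =
      algebraMap (Analytic C) (Mer C) (Analytic.monomial 1 (qElt k K C)) * thetaQ k K C := by
    rw [thetaQ, sigmaQ_algebraMap, Analytic.dilation_theta, map_mul]
  have hx : deltaX C (algebraMap (Analytic C) (Mer C) (Analytic.monomial 1 (qElt k K C))) =
      algebraMap (Analytic C) (Mer C) (Analytic.monomial 1 (qElt k K C)) := by
    rw [deltaX, fractionDerivation_algebraMap]
    congr 1
    ext n
    rw [Analytic.coeff_eulerX]
    rcases eq_or_ne n 1 with rfl | hn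
    · simp
    · simp [Analytic.monomial, Pi.single_eq_of_ne hn]
  have h0 := thetaQ_ne_zero k K C
  rw [ellQ, map_div₀, sigmaQ_deltaX, hs, Derivation.leibniz, hx, smul_eq_mul, smul_eq_mul]
  field_simp

theorem sigmaQ_delta (f : Mer C) : sigmaQ k K C (delta k K C f) = delta k K C (sigmaQ k K C f) := by
  simp only [delta, Derivation.add_apply, Derivation.smul_apply, smul_eq_mul, map_add, map_mul,
    sigmaQ_ellQ, ← sigmaQ_deltaQMer, ← sigmaQ_deltaX]
  ring

/-- The field `C_E` of elliptic functions on the torus `C* / q^ℤ`: the meromorphic functions on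
`C*` which are invariant under `σ_q`. -/
def ellipticSubfield : Subfield (Mer C) where
  carrier := {f | sigmaQ k K C f = f}
  mul_mem' := fun {a b} (ha : _ = _) (hb : _ = _) => by
    change sigmaQ k K C (a * b) = a * b
    rw [map_mul, ha, hb]
  one_mem' := map_one _
  add_mem' := fun {a b} (ha : _ = _) (hb : _ = _) => by
    change sigmaQ k K C (a + b) = a + b
    rw [map_add, ha, hb]
  zero_mem' := map_zero _
  neg_mem' := fun {a} (ha : _ = _) => by
    change sigmaQ k K C (-a) = -a
    rw [map_neg, ha]
  inv_mem' := fun a (ha : _ = _) => by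
    change sigmaQ k K C a⁻¹ = a⁻¹
    rw [map_inv₀, ha]

/-- The field `C_E` of elliptic functions. -/
def CE : Type w := ellipticSubfield k K C

instance : Field (CE k K C) := inferInstanceAs (Field (ellipticSubfield k K C))
instance : Algebra (CE k K C) (Mer C) := (ellipticSubfield k K C).subtype.toAlgebra

/-- The restriction to `C_E` of a derivation of the field of meromorphic functions which commutes
with `σ_q`. -/
def restrictCE (D : Derivation ℤ (Mer C) (Mer C))
    (hD : ∀ f, sigmaQ k K C (D f) = D (sigmaQ k K C f)) : Derivation ℤ (CE k K C) (CE k K C) :=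
  Derivation.mk' (AddMonoidHom.toIntLinearMap
    { toFun := fun f => ⟨D f.1, by
        have hf : sigmaQ k K C f.1 = f.1 := f.2
        change sigmaQ k K C (D f.1) = D f.1
        rw [hD, hf]⟩
      map_zero' := Subtype.ext (map_zero D)
      map_add' := fun f g => Subtype.ext (map_add D f.1 g.1) })
    (fun f g => Subtype.ext (D.leibniz f.1 g.1))

theorem algebraMap_restrictCE (D : Derivation ℤ (Mer C) (Mer C))
    (hD : ∀ f, sigmaQ k K C (D f) = D (sigmaQ k K C f)) (f : CE k K C) :
    D (algebraMap (CE k K C) (Mer C) f) = algebraMap (CE k K C) (Mer C) (restrictCE k K C D hD f) :=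
  rfl

/-- The derivation `δ_x` of `C_E`. -/
def deltaXCE : Derivation ℤ (CE k K C) (CE k K C) :=
  restrictCE k K C (deltaX C) (sigmaQ_deltaX k K C)

/-- The derivation `δ` of `C_E`. -/
def deltaCE : Derivation ℤ (CE k K C) (CE k K C) :=
  restrictCE k K C (delta k K C) (sigmaQ_delta k K C)

/-- The elliptic function `δ_x(ℓ_q)`. -/
def deltaXEllQ : CE k K C :=
  ⟨deltaX C (ellQ k K C), by
    change sigmaQ k K C (deltaX C (ellQ k K C)) = deltaX C (ellQ k K C)
    rw [sigmaQ_deltaX, sigmaQ_ellQ, map_add, Derivation.map_one_eq_zero, add_zero]⟩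

end Meromorphic

/-! ### Differential closures for two derivations with `[δ₁, δ₂] = c δ₁` -/

section DifferentialClosure

universe w

/-- `(L, d₁, d₂)` is a differential field extension of `(E, D₁, D₂)`, where the commutation relation
`d₁ ∘ d₂ - d₂ ∘ d₁ = c d₁` is imposed, `c ∈ E`. -/
structure IsDiffExtension {E L : Type*} [Field E] [Field L] [Algebra E L]
    (D₁ D₂ : Derivation ℤ E E) (c : E) (d₁ d₂ : Derivation ℤ L L) : Prop where
  map₁ : ∀ a, d₁ (algebraMap E L a) = algebraMap E L (D₁ a)
  map₂ : ∀ a, d₂ (algebraMap E L a) = algebraMap E L (D₂ a)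
  comm : ∀ y, d₁ (d₂ y) - d₂ (d₁ y) = algebraMap E L c * d₁ y

/-- The differential operator `d_{i₁} ∘ ⋯ ∘ d_{iₘ}` given by a word in two letters
(`false` stands for `d₁` and `true` for `d₂`). -/
def wordOp {M : Type*} [CommRing M] (d₁ d₂ : Derivation ℤ M M) : List Bool → M → M
  | [], y => y
  | false :: w, y => d₁ (wordOp d₁ d₂ w y)
  | true :: w, y => d₂ (wordOp d₁ d₂ w y)

/-- Differential polynomials in `n` unknowns `Y i` with coefficients in `L`: the polynomials in the
symbols `w Y i`, where `w` is a word in the two derivations. -/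
abbrev DiffPolynomial (n : ℕ) (L : Type*) [CommRing L] : Type _ := MvPolynomial (Fin n × List Bool) L

/-- The value of a differential polynomial at an `n`-tuple of elements of `(M, d₁, d₂)`. -/
def DiffPolynomial.value {n : ℕ} {L M : Type*} [CommRing L] [CommRing M] [Algebra L M]
    (d₁ d₂ : Derivation ℤ M M) (y : Fin n → M) (p : DiffPolynomial n L) : M :=
  MvPolynomial.aeval (fun s : Fin n × List Bool => wordOp d₁ d₂ s.2 (y s.1)) p

/-- `(L, d₁, d₂)` is differentially closed (for the relation `[d₁, d₂] = c d₁`): every finite system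
of algebraic differential equations with coefficients in `L` which has a solution in some
differential field extension of `L` has a solution in `L`. -/
def IsDiffClosed {L : Type w} [Field L] (d₁ d₂ : Derivation ℤ L L) (c : L) : Prop :=
  ∀ (M : Type w) [Field M] [Algebra L M] (e₁ e₂ : Derivation ℤ M M),
    IsDiffExtension d₁ d₂ c e₁ e₂ →
    ∀ (n : ℕ) (P : Finset (DiffPolynomial n L)),
      (∃ y : Fin n → M, ∀ p ∈ P, p.value e₁ e₂ y = 0) →
      ∃ y : Fin n → L, ∀ p ∈ P, p.value d₁ d₂ y = 0

/-- `(L, d₁, d₂)` is a differential closure of `(E, D₁, D₂)`: a differentially closed differential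
field extension which embeds over `E` into every differentially closed differential field
extension of `E`. -/
structure IsDiffClosure {E L : Type w} [Field E] [Field L] [Algebra E L]
    (D₁ D₂ : Derivation ℤ E E) (c : E) (d₁ d₂ : Derivation ℤ L L) : Prop where
  isDiffExtension : IsDiffExtension D₁ D₂ c d₁ d₂
  isDiffClosed : IsDiffClosed d₁ d₂ (algebraMap E L c)
  exists_embedding : ∀ (M : Type w) [Field M] [Algebra E M] (e₁ e₂ : Derivation ℤ M M),
    IsDiffExtension D₁ D₂ c e₁ e₂ → IsDiffClosed e₁ e₂ (algebraMap E M c) →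
    ∃ φ : L →ₐ[E] M, (∀ y, φ (d₁ y) = e₁ (φ y)) ∧ ∀ y, φ (d₂ y) = e₂ (φ y)

end DifferentialClosure

/-! ### The ring generated by a differential closure of `C_E` and the meromorphic functions -/

section Compositum

universe u v w

variable (k : Type u) (K : Type v) (C : Type w) [Field k] [CharZero k]
  [NormedField K] [Algebra (RatFunc k) K]
  [NormedField C] [NormedAlgebra K C] [IsUltrametricDist C] [CompleteSpace C] [IsAlgClosed C]
  [BaseSetting k K C]
  (L : Type w) [Field L] [Algebra (CE k K C) L]

/-- The total ring of fractions of `L ⊗ Mer(C*)` over `C_E`, for an extension `L` of `C_E`. It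
contains `L`, the field of meromorphic functions and the field `L(x, ℓ_q)`. -/
def Compositum : Type w := FractionRing (TensorRing (CE k K C) L (Mer C))

instance : CommRing (Compositum k K C L) :=
  inferInstanceAs (CommRing (FractionRing (TensorRing (CE k K C) L (Mer C))))
instance : Algebra (TensorRing (CE k K C) L (Mer C)) (Compositum k K C L) :=
  inferInstanceAs (Algebra (TensorRing (CE k K C) L (Mer C))
    (FractionRing (TensorRing (CE k K C) L (Mer C))))
instance : IsFractionRing (TensorRing (CE k K C) L (Mer C)) (Compositum k K C L) :=
  inferInstanceAs (IsFractionRing (TensorRing (CE k K C) L (Mer C))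
    (FractionRing (TensorRing (CE k K C) L (Mer C))))

namespace Compositum

/-- The map of `L` to the compositum. -/
def ofClosure : L →+* Compositum k K C L :=
  (algebraMap (TensorRing (CE k K C) L (Mer C)) (Compositum k K C L)).comp
    (TensorRing.inl (CE k K C) (Mer C))

/-- The map of the field of meromorphic functions to the compositum. -/
def ofMer : Mer C →+* Compositum k K C L :=
  (algebraMap (TensorRing (CE k K C) L (Mer C)) (Compositum k K C L)).comp
    (TensorRing.inr (CE k K C) L)

/-- The operator `σ_q` of the compositum: the identity on `L`, and `f(x) ↦ f(q x)` on the
meromorphic functions. -/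
def sigma : Compositum k K C L ≃+* Compositum k K C L :=
  IsFractionRing.ringEquivOfRingEquiv (TensorRing.mapRight (A := L) (sigmaQ k K C)
    (fun r : CE k K C => r.2))

variable {L} {d₁ d₂ : Derivation ℤ L L}
  (hL : IsDiffExtension (deltaXCE k K C) (deltaCE k K C) (deltaXEllQ k K C) d₁ d₂)

/-- The derivation `δ_x` of the compositum: the given one on `L`, and `x d/dx` on the
meromorphic functions. -/
def dX : Derivation ℤ (Compositum k K C L) (Compositum k K C L) :=
  fractionDerivation _ (TensorRing.derivation (deltaXCE k K C) d₁ (deltaX C) hL.map₁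
    (algebraMap_restrictCE k K C _ (sigmaQ_deltaX k K C)))

/-- The derivation `δ` of the compositum: the given one on `L`, and `ℓ_q δ_x + δ_q` on the
meromorphic functions. -/
def dDelta : Derivation ℤ (Compositum k K C L) (Compositum k K C L) :=
  fractionDerivation _ (TensorRing.derivation (deltaCE k K C) d₂ (delta k K C) hL.map₂
    (algebraMap_restrictCE k K C _ (sigmaQ_delta k K C)))

variable (L)

theorem ofClosure_algebraMap (a : CE k K C) :
    ofClosure k K C L (algebraMap (CE k K C) L a) =
      ofMer k K C L (algebraMap (CE k K C) (Mer C) a) :=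
  congrArg (algebraMap (TensorRing (CE k K C) L (Mer C)) (Compositum k K C L))
    (TensorRing.inl_algebraMap a)

theorem sigma_ofClosure (y : L) : sigma k K C L (ofClosure k K C L y) = ofClosure k K C L y := 
  (IsFractionRing.ringEquivOfRingEquiv_algebraMap _ _).trans
    (congrArg _ (TensorRing.mapRight_inl _ _ y))

theorem sigma_ofMer (f : Mer C) :
    sigma k K C L (ofMer k K C L f) = ofMer k K C L (sigmaQ k K C f) := 
  (IsFractionRing.ringEquivOfRingEquiv_algebraMap _ _).trans
    (congrArg _ (TensorRing.mapRight_inr _ _ f))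

variable {L}

theorem dX_ofClosure (y : L) : dX k K C hL (ofClosure k K C L y) = ofClosure k K C L (d₁ y) := 
  (fractionDerivation_algebraMap _ _ _).trans
    (congrArg _ (TensorRing.derivation_inl _ _ _ _ _ y))

theorem dX_ofMer (f : Mer C) : dX k K C hL (ofMer k K C L f) = ofMer k K C L (deltaX C f) :=
  (fractionDerivation_algebraMap _ _ _).trans
    (congrArg _ (TensorRing.derivation_inr _ _ _ _ _ f))

theorem dDelta_ofClosure (y : L) :
    dDelta k K C hL (ofClosure k K C L y) = ofClosure k K C L (d₂ y) := 
  (fractionDerivation_algebraMap _ _ _).trans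
    (congrArg _ (TensorRing.derivation_inl _ _ _ _ _ y))

theorem dDelta_ofMer (f : Mer C) :
    dDelta k K C hL (ofMer k K C L f) = ofMer k K C L (delta k K C f) := 
  (fractionDerivation_algebraMap _ _ _).trans
    (congrArg _ (TensorRing.derivation_inr _ _ _ _ _ f))

end Compositum

end Compositum

end

end QDependency

universe u v w

/-! Write $c=\delta_x(\ell_q)$. For any $h$ in $L$, the relation $[\delta_x,\delta]=c\,\delta_x$
gives $[h\delta_x,\delta]=(hc-\delta(h))\,\delta_x$. Hence $h\delta_x$ commutes with $\delta$ as
soon as $\delta(h)=ch$. What remains is to find a nonzero such $h$, and to check that the relation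
and the commutation with $\sigma_q$ pass from the two fields to the compositum.

A nonzero $h$ exists because $L$ is closed: it is enough to solve $\delta(u)=cu$, $u\ne 0$, in some
extension of $L$ that still satisfies the commutation relation. The equation imposes no condition on
the successive $\delta_x$-derivatives $u_i$ of $u=u_0$, since the relation expresses every
$\delta(u_i)$ through the $u_j$. So the $u_i$ can be taken algebraically independent: on
$L[u_0,u_1,\dots]$ put $D_1u_i=u_{i+1}$, $D_2u_0=cu_0$ and let the relation dictate $D_2u_{i+1}$.
That the relation then holds everywhere is `commutator_shiftDerivation_twistedDerivation`; its field
of fractions is the extension needed in `exists_isDiffExtension_eq_mul`, and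
`IsDiffClosed.exists_ne_zero_eq_mul` brings the solution down to $L$.

On meromorphic functions $\delta_x$ and $\delta_q$ commute, which gives the relation there
(`deltaX_delta_sub`). The derivation $\delta_q$ does not commute with $\sigma_q$, but the correction
$\ell_q\delta_x$ repairs this, because $\sigma_q(\ell_q)=\ell_q+1$. On $L$ the operator $\sigma_q$
is the identity and the relation is part of the hypothesis. Both sides of each identity on the
compositum obey the same (possibly $\sigma_q$-twisted) Leibniz rule, so by `Compositum.twisted_ext`
it suffices to compare them on $L$ and on the meromorphic functions. This argument needs only that
denominators are units, so it does not matter whether the tensor product is a domain. -/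

namespace QDependency

/-! ### Derivations determined by their values on numerators -/

section DerivationExtensionality

/-- Two derivations of a total ring of fractions which agree on the numerators are equal. -/
theorem fractionDerivation_ext {R S : Type*} [CommRing R] [CommRing S] [Algebra R S]
    [IsFractionRing R S] {D E : Derivation ℤ S S}
    (h : ∀ r : R, D (algebraMap R S r) = E (algebraMap R S r)) : D = E :=
  Derivation.ext fun y => fraction_ext R (RingHom.id S) (D := D) (E := E)
    (fun a b => by simp) (fun a b => by simp) h y

/-- A derivation satisfies the relation `[D₁, D₂] = c D₁` if the difference of both sides, which is
a derivation, vanishes. -/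
theorem commutator_apply_of_eq {S : Type*} [CommRing S] {D₁ D₂ : Derivation ℤ S S} {c : S}
    (h : ⁅D₁, D₂⁆ = c • D₁) (y : S) : D₁ (D₂ y) - D₂ (D₁ y) = c * D₁ y := by
  have := congrArg (fun D : Derivation ℤ S S => D y) h
  simpa [Derivation.commutator_apply] using this

end DerivationExtensionality

/-! ### Derivations of polynomial rings with prescribed values -/

section PolynomialDerivation

variable {ι A : Type*} [CommRing A]

/-- The dual-number homomorphism of `mvPolynomialDerivation`. -/
noncomputable def mvPolynomialDualHom (D : Derivation ℤ A A) (v : ι → MvPolynomial ι A) :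
    MvPolynomial ι A →+* TrivSqZeroExt (MvPolynomial ι A) (MvPolynomial ι A) :=
  MvPolynomial.eval₂Hom (dualHom MvPolynomial.C D)
    (fun i => TrivSqZeroExt.inl (MvPolynomial.X i) + TrivSqZeroExt.inr (v i))

/-- The derivation of a polynomial ring which extends a derivation `D` of the coefficients and
takes prescribed values at the indeterminates. -/
noncomputable def mvPolynomialDerivation (D : Derivation ℤ A A) (v : ι → MvPolynomial ι A) :
    Derivation ℤ (MvPolynomial ι A) (MvPolynomial ι A) :=
  derivationOfDualHom (mvPolynomialDualHom D v) (fun s => by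
    -- A ring homomorphism to the dual numbers is a derivation once its first component is the
    -- identity, and this can be tested on constants and indeterminates.
    have : (TrivSqZeroExt.fstHom (MvPolynomial ι A) (MvPolynomial ι A)
        (MvPolynomial ι A)).toRingHom.comp (mvPolynomialDualHom D v) = RingHom.id _ := by
      refine MvPolynomial.ringHom_ext (fun a => ?_) (fun i => ?_)
      · simp [mvPolynomialDualHom, dualHom]
      · simp [mvPolynomialDualHom]
    exact congrArg (fun g => g s) this)

@[simp] theorem mvPolynomialDerivation_C (D : Derivation ℤ A A) (v : ι → MvPolynomial ι A) (a : A) :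
    mvPolynomialDerivation D v (MvPolynomial.C a) = MvPolynomial.C (D a) := by
  change (mvPolynomialDualHom D v (MvPolynomial.C a)).snd = _
  simp [mvPolynomialDualHom, dualHom]

@[simp] theorem mvPolynomialDerivation_X (D : Derivation ℤ A A) (v : ι → MvPolynomial ι A) (i : ι) :
    mvPolynomialDerivation D v (MvPolynomial.X i) = v i := by
  change (mvPolynomialDualHom D v (MvPolynomial.X i)).snd = _
  simp [mvPolynomialDualHom]

/-- Two derivations of a polynomial ring which agree on the constants and the indeterminates are
equal. -/
theorem mvPolynomialDerivation_ext {D E : Derivation ℤ (MvPolynomial ι A) (MvPolynomial ι A)}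
    (hC : ∀ a, D (MvPolynomial.C a) = E (MvPolynomial.C a))
    (hX : ∀ i, D (MvPolynomial.X i) = E (MvPolynomial.X i)) : D = E := by
  refine Derivation.ext fun p => ?_
  induction p using MvPolynomial.induction_on with
  | C a => exact hC a
  | add p q hp hq => rw [map_add, map_add, hp, hq]
  | mul_X p i hp => rw [Derivation.leibniz, Derivation.leibniz, hp, hX]

end PolynomialDerivation

/-! ### The generic solution of $D_2u=cu$ over a ring with $[d_1,d_2]=c\,d_1$ -/

section GenericSolution

variable {A : Type*} [CommRing A] (d₁ d₂ : Derivation ℤ A A) (c : A)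

/-- The derivation `D₁` of `A[u₀, u₁, …]` with `D₁ uᵢ = uᵢ₊₁`. -/
noncomputable def shiftDerivation : Derivation ℤ (MvPolynomial ℕ A) (MvPolynomial ℕ A) :=
  mvPolynomialDerivation d₁ (fun i => MvPolynomial.X (i + 1))

/-- The values at `uᵢ = D₁ⁱ u₀` of a derivation `D₂` with `D₂ u₀ = c u₀` and
`[D₁, D₂] = c D₁`. -/
noncomputable def twistedValue : ℕ → MvPolynomial ℕ A
  | 0 => MvPolynomial.C c * MvPolynomial.X 0
  -- The relation at $u_i$ forces this value: $D_2u_{i+1}=D_2D_1u_i=D_1D_2u_i-c\,D_1u_i$, with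
  -- $D_1u_i=u_{i+1}$.
  | i + 1 => shiftDerivation d₁ (twistedValue i) - MvPolynomial.C c * MvPolynomial.X (i + 1)

/-- The derivation `D₂` of `A[u₀, u₁, …]` with `D₂ u₀ = c u₀` and `[D₁, D₂] = c D₁`. -/
noncomputable def twistedDerivation : Derivation ℤ (MvPolynomial ℕ A) (MvPolynomial ℕ A) :=
  mvPolynomialDerivation d₂ (twistedValue d₁ c)

/-- Both sides are derivations, so only constants and indeterminates have to be compared. On
constants the identity is `hcomm`; at $u_i$ it is the recursion that defines `twistedValue` at
$i+1$. -/
theorem commutator_shiftDerivation_twistedDerivation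
    (hcomm : ∀ y, d₁ (d₂ y) - d₂ (d₁ y) = c * d₁ y) :
    ⁅shiftDerivation d₁, twistedDerivation d₁ d₂ c⁆ =
      (MvPolynomial.C c : MvPolynomial ℕ A) • shiftDerivation d₁ := by
  refine mvPolynomialDerivation_ext (fun a => ?_) (fun i => ?_)
  · simp only [Derivation.commutator_apply, Derivation.smul_apply, smul_eq_mul, shiftDerivation,
      twistedDerivation, mvPolynomialDerivation_C, ← map_sub, ← map_mul, hcomm]
  · have h1 : shiftDerivation d₁ (MvPolynomial.X i) = MvPolynomial.X (i + 1) :=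
      mvPolynomialDerivation_X _ _ _
    have h2 (j : ℕ) : twistedDerivation d₁ d₂ c (MvPolynomial.X j) = twistedValue d₁ c j :=
      mvPolynomialDerivation_X _ _ _
    rw [Derivation.commutator_apply, Derivation.smul_apply, smul_eq_mul, h1, h2, h2, twistedValue]
    ring

end GenericSolution

/-! ### Passage to fractions and existence of $h$ -/

/-- A derivation of the fractions is determined on numerators, and there both sides come from the
given relation. This carries the relation from $L[u_0,u_1,\dots]$ to its field of fractions. -/
theorem commutator_fractionDerivation {R : Type*} (S : Type*) [CommRing R] [CommRing S]
    [Algebra R S] [IsFractionRing R S] {D₁ D₂ : Derivation ℤ R R} {c : R}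
    (h : ⁅D₁, D₂⁆ = c • D₁) :
    ⁅fractionDerivation S D₁, fractionDerivation S D₂⁆ =
      algebraMap R S c • fractionDerivation S D₁ := by
  refine fractionDerivation_ext (R := R) fun r => ?_
  simp only [Derivation.commutator_apply, Derivation.smul_apply, smul_eq_mul,
    fractionDerivation_algebraMap, ← map_sub, ← map_mul, commutator_apply_of_eq h]

/-- Every differential field with `[d₁, d₂] = c d₁` has an extension, the field of fractions of
`L[u₀, u₁, …]`, in which the equation `e₂ u = c u` has a nonzero solution. -/
theorem exists_isDiffExtension_eq_mul {L M : Type*} [Field L] [Field M]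
    [Algebra (MvPolynomial ℕ L) M] [IsFractionRing (MvPolynomial ℕ L) M] [Algebra L M]
    [IsScalarTower L (MvPolynomial ℕ L) M] {d₁ d₂ : Derivation ℤ L L} {c : L}
    (hcomm : ∀ y, d₁ (d₂ y) - d₂ (d₁ y) = c * d₁ y) :
    ∃ e₁ e₂ : Derivation ℤ M M, IsDiffExtension d₁ d₂ c e₁ e₂ ∧
      ∃ u : M, u ≠ 0 ∧ e₂ u = algebraMap L M c * u := by
  have halg (a : L) : algebraMap L M a = algebraMap (MvPolynomial ℕ L) M (MvPolynomial.C a) :=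
    IsScalarTower.algebraMap_apply L (MvPolynomial ℕ L) M a
  -- The solution is the indeterminate $u_0$: it is nonzero because the polynomial ring embeds in
  -- its fractions, and it satisfies the equation by the initial value of the recursion.
  refine ⟨fractionDerivation M (shiftDerivation d₁),
    fractionDerivation M (twistedDerivation d₁ d₂ c), ⟨fun a => ?_, fun a => ?_, fun y => ?_⟩,
    algebraMap (MvPolynomial ℕ L) M (MvPolynomial.X 0), ?_, ?_⟩
  · rw [halg, halg]
    exact (fractionDerivation_algebraMap M _ _).trans
      (congrArg _ (mvPolynomialDerivation_C _ _ a))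
  · rw [halg, halg]
    exact (fractionDerivation_algebraMap M _ _).trans
      (congrArg _ (mvPolynomialDerivation_C _ _ a))
  · rw [halg]
    exact commutator_apply_of_eq (commutator_fractionDerivation M
      (commutator_shiftDerivation_twistedDerivation d₁ d₂ c hcomm)) y
  · rw [Ne, IsFractionRing.to_map_eq_zero_iff]
    exact MvPolynomial.X_ne_zero 0
  · rw [halg, ← map_mul]
    exact (fractionDerivation_algebraMap M _ _).trans
      (congrArg _ (mvPolynomialDerivation_X _ _ 0))

/-- In a differentially closed field with `[d₁, d₂] = c d₁` the equation `d₂ h = c h` has a nonzero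
solution. -/
theorem IsDiffClosed.exists_ne_zero_eq_mul {L : Type w} [Field L] {d₁ d₂ : Derivation ℤ L L} {c : L}
    (hL : IsDiffClosed d₁ d₂ c) (hcomm : ∀ y, d₁ (d₂ y) - d₂ (d₁ y) = c * d₁ y) :
    ∃ h : L, h ≠ 0 ∧ d₂ h = c * h := by
  classical
  obtain ⟨e₁, e₂, hext, u, hu, hu2⟩ := exists_isDiffExtension_eq_mul
    (M := FractionRing (MvPolynomial ℕ L)) hcomm
  -- The unknowns are $Y_0=h$ and an auxiliary $Y_1$. A system consists of equations only, so $h\ne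
  -- 0$ is encoded by $Y_0Y_1-1=0$. The empty word leaves an unknown as it is, and `[true]` applies
  -- the second derivation to it.
  let p : DiffPolynomial 2 L :=
    MvPolynomial.X (0, [true]) - MvPolynomial.C c * MvPolynomial.X (0, [])
  let p' : DiffPolynomial 2 L := MvPolynomial.X (0, []) * MvPolynomial.X (1, []) - 1
  obtain ⟨y, hy⟩ := hL _ e₁ e₂ hext 2 {p, p'} ⟨![u, u⁻¹], by
    intro P hP
    rcases Finset.mem_insert.mp hP with rfl | hP
    · simp [p, DiffPolynomial.value, wordOp, hu2]
    · rw [Finset.mem_singleton.mp hP]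
      simp [p', DiffPolynomial.value, wordOp, hu]⟩
  have h1 : d₂ (y 0) - c * y 0 = 0 := by
    simpa [p, DiffPolynomial.value, wordOp] using hy p (by simp)
  have h2 : y 0 * y 1 - 1 = 0 := by
    simpa [p', DiffPolynomial.value, wordOp] using hy p' (by simp)
  exact ⟨y 0, left_ne_zero_of_mul_eq_one (sub_eq_zero.mp h2), sub_eq_zero.mp h1⟩

/-! ### Commutators on the meromorphic functions -/

section Compositum

variable (k : Type u) (K : Type v) (C : Type w) [Field k] [CharZero k]
  [NormedField K] [Algebra (RatFunc k) K]
  [NormedField C] [NormedAlgebra K C] [IsUltrametricDist C] [CompleteSpace C] [IsAlgClosed C]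
  [BaseSetting k K C]

/-- On Laurent series $\delta_x$ multiplies the $n$-th coefficient by the integer $n$ and $\delta_q$
acts on each coefficient. These operations commute since a derivation of $C$ kills integers; the
commutator, being a derivation, then vanishes on the quotients too. -/
theorem deltaX_deltaQMer (f : Mer C) :
    deltaX C (deltaQMer k K C f) = deltaQMer k K C (deltaX C f) := by
  have h : ⁅deltaX C, deltaQMer k K C⁆ = 0 := by
    refine fractionDerivation_ext (R := Analytic C) fun f => ?_
    rw [Derivation.commutator_apply, Derivation.zero_apply, sub_eq_zero]
    simp only [deltaX, deltaQMer, fractionDerivation_algebraMap]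
    congr 1
    ext n
    simp
  have := congrArg (fun D : Derivation ℤ (Mer C) (Mer C) => D f) h
  rwa [Derivation.commutator_apply, Derivation.zero_apply, sub_eq_zero] at this

/-- Expanding $[\delta_x,\ell_q\delta_x+\delta_q]$, the only term that survives comes from
differentiating the factor $\ell_q$, as $\delta_x$ commutes with itself and with $\delta_q$. -/
theorem deltaX_delta_sub (f : Mer C) :
    deltaX C (delta k K C f) - delta k K C (deltaX C f) = deltaX C (ellQ k K C) * deltaX C f := by
  simp only [delta, Derivation.add_apply, Derivation.smul_apply, smul_eq_mul, map_add,
    Derivation.leibniz, deltaX_deltaQMer]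
  ring

/-! ### Transfer of the commutation relations to the compositum -/

namespace Compositum

variable {k K C} {L : Type w} [Field L] [Algebra (CE k K C) L]

/-- Additive maps of the compositum which satisfy a common twisted Leibniz rule and agree on `L` and
on the meromorphic functions agree. -/
theorem twisted_ext (σ : Compositum k K C L →+* Compositum k K C L)
    {D E : Compositum k K C L → Compositum k K C L}
    (hD0 : ∀ a b, D (a + b) = D a + D b) (hE0 : ∀ a b, E (a + b) = E a + E b)
    (hD : ∀ a b, D (a * b) = σ a * D b + σ b * D a) (hE : ∀ a b, E (a * b) = σ a * E b + σ b * E a)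
    (hl : ∀ y, D (ofClosure k K C L y) = E (ofClosure k K C L y))
    (hr : ∀ f, D (ofMer k K C L f) = E (ofMer k K C L f)) (z : Compositum k K C L) : D z = E z := by
  refine fraction_ext (TensorRing (CE k K C) L (Mer C)) σ (D := D) (E := E) hD hE (fun t => ?_) z
  induction t using TensorRing.induction with
  | zero =>
    -- `D` and `E` are bare functions, so their vanishing at $0$ has to be derived from additivity.
    have h1 := hD0 0 0
    have h2 := hE0 0 0
    rw [add_zero, left_eq_add] at h1 h2
    rw [map_zero, h1, h2]
  | mul a b =>
    rw [map_mul]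
    change D (ofClosure k K C L a * ofMer k K C L b) = E (ofClosure k K C L a * ofMer k K C L b)
    rw [hD, hE, hl, hr]
  | add x y hx hy => rw [map_add, hD0, hE0, hx, hy]

/-- A derivation of the compositum commutes with `σ_q` if it does so on `L` and on the meromorphic
functions. -/
theorem derivation_sigma (D : Derivation ℤ (Compositum k K C L) (Compositum k K C L))
    (hl : ∀ y, D (sigma k K C L (ofClosure k K C L y)) = sigma k K C L (D (ofClosure k K C L y)))
    (hr : ∀ f, D (sigma k K C L (ofMer k K C L f)) = sigma k K C L (D (ofMer k K C L f)))
    (z : Compositum k K C L) : D (sigma k K C L z) = sigma k K C L (D z) :=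
  -- Both $D\circ\sigma$ and $\sigma\circ D$ send $ab$ to $\sigma(a)(\cdot)(b)+\sigma(b)(\cdot)(a)$;
  -- this is why the extensionality lemma allows a twist.
  twisted_ext (sigma k K C L : Compositum k K C L →+* Compositum k K C L)
    (D := fun z => D (sigma k K C L z)) (E := fun z => sigma k K C L (D z))
    (fun a b => by simp) (fun a b => by simp) (fun a b => by simp) (fun a b => by simp) hl hr z

variable {d₁ d₂ : Derivation ℤ L L}
  (hL : IsDiffExtension (deltaXCE k K C) (deltaCE k K C) (deltaXEllQ k K C) d₁ d₂)

theorem dX_sigma (z : Compositum k K C L) :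
    dX k K C hL (sigma k K C L z) = sigma k K C L (dX k K C hL z) :=
  derivation_sigma _ (fun y => by rw [sigma_ofClosure, dX_ofClosure, sigma_ofClosure])
    (fun f => by rw [sigma_ofMer, dX_ofMer, dX_ofMer, sigma_ofMer, sigmaQ_deltaX]) z

/-- On the meromorphic functions this rests on the cancellation in `sigmaQ_delta`: the extra
$\delta_x$ produced by moving $\delta_q$ past $\sigma_q$ is absorbed by $\sigma_q(\ell_q)=\ell_q+1$.
-/
theorem dDelta_sigma (z : Compositum k K C L) :
    dDelta k K C hL (sigma k K C L z) = sigma k K C L (dDelta k K C hL z) :=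
  derivation_sigma _ (fun y => by rw [sigma_ofClosure, dDelta_ofClosure, sigma_ofClosure])
    (fun f => by rw [sigma_ofMer, dDelta_ofMer, dDelta_ofMer, sigma_ofMer, sigmaQ_delta]) z

/-- The relation `[δ_x, δ] = δ_x(ℓ_q) δ_x` holds on the compositum. -/
theorem dX_dDelta_sub (z : Compositum k K C L) :
    dX k K C hL (dDelta k K C hL z) - dDelta k K C hL (dX k K C hL z) =
      ofClosure k K C L (algebraMap (CE k K C) L (deltaXEllQ k K C)) * dX k K C hL z := by
  set c := ofClosure k K C L (algebraMap (CE k K C) L (deltaXEllQ k K C)) with hc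
  let D : Derivation ℤ (Compositum k K C L) (Compositum k K C L) := ⁅dX k K C hL, dDelta k K C hL⁆
  let E : Derivation ℤ (Compositum k K C L) (Compositum k K C L) := c • dX k K C hL
  refine commutator_apply_of_eq (Derivation.ext fun z => ?_ : D = E) z
  -- With the identity as twist the rule is the ordinary Leibniz rule, which the commutator and the
  -- multiple $c\,\delta_x$ both satisfy.
  refine twisted_ext (RingHom.id _) (D := D) (E := E) (map_add D) (map_add E)
    (fun a b => by simp) (fun a b => by simp) (fun y => ?_) (fun f => ?_) z
  · simp only [D, E, Derivation.commutator_apply, Derivation.smul_apply, smul_eq_mul,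
      dX_ofClosure, dDelta_ofClosure, ← map_sub, hL.comm, map_mul, hc]
  -- On meromorphic functions the factor $c$, which enters through $L$, must be read as the function
  -- $\delta_x(\ell_q)$; the two images of $C_E$ in the compositum agree, and the inclusion of $C_E$
  -- in the meromorphic functions is definitional.
  · simp only [D, E, Derivation.commutator_apply, Derivation.smul_apply, smul_eq_mul,
      dX_ofMer, dDelta_ofMer, ← map_sub, deltaX_delta_sub, map_mul, hc, ofClosure_algebraMap]
    rfl

end Compositum

end Compositum

end QDependency

/-! ### The commuting derivations -/

theorem mainTheorem11 {k : Type u} {K : Type v} {C : Type w} [Field k] [CharZero k]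
    [NormedField K] [Algebra (RatFunc k) K]
    [NormedField C] [NormedAlgebra K C] [IsUltrametricDist C] [CompleteSpace C] [IsAlgClosed C]
    [QDependency.BaseSetting k K C]
    {L : Type w} [Field L] [Algebra (QDependency.CE k K C) L] (d₁ d₂ : Derivation ℤ L L)
    (hL : QDependency.IsDiffClosure (QDependency.deltaXCE k K C) (QDependency.deltaCE k K C)
      (QDependency.deltaXEllQ k K C) d₁ d₂) :
    ∃ h : L, h ≠ 0 ∧
      d₂ h = algebraMap (QDependency.CE k K C) L (QDependency.deltaXEllQ k K C) * h ∧
      let partial₁ : Derivation ℤ (QDependency.Compositum k K C L) (QDependency.Compositum k K C L) :=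
        QDependency.Compositum.ofClosure k K C L h •
          QDependency.Compositum.dX k K C hL.isDiffExtension
      let partial₂ : Derivation ℤ (QDependency.Compositum k K C L) (QDependency.Compositum k K C L) :=
        QDependency.Compositum.dDelta k K C hL.isDiffExtension
      let σ : QDependency.Compositum k K C L ≃+* QDependency.Compositum k K C L :=
        QDependency.Compositum.sigma k K C L
      (∀ f, partial₁ (partial₂ f) = partial₂ (partial₁ f)) ∧
      (∀ f, partial₁ (σ f) = σ (partial₁ f)) ∧
      (∀ f, partial₂ (σ f) = σ (partial₂ f)) := by
  obtain ⟨h, h0, hd⟩ := hL.isDiffClosed.exists_ne_zero_eq_mul hL.isDiffExtension.comm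
  refine ⟨h, h0, hd, fun f => ?_, fun f => ?_, fun f => ?_⟩
  · have hf := QDependency.Compositum.dX_dDelta_sub hL.isDiffExtension f
    simp only [Derivation.smul_apply, smul_eq_mul, Derivation.leibniz,
      QDependency.Compositum.dDelta_ofClosure, hd, map_mul]
    -- After the Leibniz rule and $\delta(h)=ch$, the claim is $h$ times the relation
    -- $[\delta_x,\delta]=c\,\delta_x$ at $f$.
    linear_combination QDependency.Compositum.ofClosure k K C L h * hf
  -- The factor $h$ passes through $\sigma_q$ because $\sigma_q$ is the identity on $L$.
  · simp only [Derivation.smul_apply, smul_eq_mul, map_mul,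
      QDependency.Compositum.sigma_ofClosure, QDependency.Compositum.dX_sigma]
  · exact QDependency.Compositum.dDelta_sigma hL.isDiffExtension f
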